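/- **Definitions.** An *ETR instance* is a sentence $\exists x\in\mathbb{R}^N:\varphi(x)$, where $\varphi$ is a Boolean combination (using $\wedge,\vee,\neg$) of atomic predicates $p(x)=0$, $p(x)\neq 0$, $p(x)\ge 0$, $p(x)>0$ with $p\in\mathbb{Z}[x_1,\dots,x_N]$. Polynomials are written in sparse form, as lists of monomials with coefficients and exponent vectors in binary. ETR is the problem of deciding whether such a sentence is true. The class $\exists\mathbb{R}$ consists of the decision problems that are reducible to ETR by a polynomial-time many-one reduction (computed by a Turing machine from the encoded instance). For an integer $k\ge 1$, $\mathrm{ARM}(k)$ is the following decision problem. Input: $m,n,q\in\mathbb{N}$, matrices $A_1,\dots,A_q\in\mathbb{Q}^{m\times n}$ and scalars $b_1,\dots,b_q\in\mathbb{Q}$, with $m,n,q$ in binary and every rational given by numerator and denominator in reduced form in binary. Question: is there $X\in\mathbb{R}^{m\times n}$ with $\operatorname{rank}(X)\le k$ and $\langle A_\ell,X\rangle=b_\ell$ for all $\ell\in\{1,\dots,q\}$, where $\langle A,X\rangle=\sum_{i,j}A_{ij}X_{ij}$? **Theorem.** For every fixed $k\ge 1$, $\mathrm{ARM}(k)\in\exists\mathbb{R}$.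 Moreover, an instance $(A_\ell,b_\ell)_{\ell=1}^q$ of $\mathrm{ARM}(k)$ is a yes-instance if and only if $$\exists\,U\in\mathbb{R}^{m\times k}\ \exists\,V\in\mathbb{R}^{k\times n}:\ \bigwedge_{\ell=1}^q\bigl(\langle A_\ell,UV\rangle=b_\ell\bigr).$$ -/

import Mathlib

/-! ### Alphabet and prefix-free binary encodings -/

/-- The finite alphabet in which problem instances are written. -/
inductive Token : Type
  | bit (b : Bool)
  | minus
  | slash
  | endNum
  | matrix
  | row
  | rhs
  | ex
  | monomial
  | endPoly
  | eqZero
  | neZero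
  | geZero
  | gtZero
  | conj
  | disj
  | neg
  deriving DecidableEq, Fintype

/-- Each code word can be split off uniquely from the front of a string. -/
def PrefixInj {α : Type} (e : α → List Token) : Prop :=
  ∀ a b s t, e a ++ s = e b ++ t → a = b ∧ s = t

theorem PrefixInj.injective {α : Type} {e : α → List Token} (h : PrefixInj e) :
    Function.Injective e := fun a b hab => (h a b [] [] (by rw [hab])).1

/-- The binary digits of a natural number (least significant digit first). -/
def bitsNat (n : ℕ) : List Token := (Computability.encodeNat n).map Token.bit

theorem bitsNat_split (c : Token) (hc : ∀ b, c ≠ Token.bit b) (m n : ℕ) (s t : List Token)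
    (h : bitsNat m ++ c :: s = bitsNat n ++ c :: t) : m = n ∧ s = t := by
  have key : ∀ (u v : List Bool), u.map Token.bit ++ c :: s = v.map Token.bit ++ c :: t →
      u = v ∧ s = t := by
    intro u
    induction u with
    | nil =>
      intro v hv
      cases v with
      | nil => simpa using hv
      | cons b v => simp at hv; exact absurd hv.1 (hc b)
    | cons a u ih =>
      intro v hv
      cases v with
      | nil => simp at hv; exact absurd hv.1.symm (hc a)
      | cons b v =>
        simp only [List.map_cons, List.cons_append, List.cons.injEq, Token.bit.injEq] at hv
        obtain ⟨h1, h2⟩ := ih v hv.2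
        exact ⟨by rw [hv.1, h1], h2⟩
  obtain ⟨h1, h2⟩ := key _ _ h
  refine ⟨?_, h2⟩
  rw [← Computability.decode_encodeNat m, h1, Computability.decode_encodeNat]

/-- A natural number in binary, closed by an end marker. -/
def encNat (n : ℕ) : List Token := bitsNat n ++ [Token.endNum]

theorem prefixInj_encNat : PrefixInj encNat := by
  intro m n s t h
  simp only [encNat, List.append_assoc, List.singleton_append] at h
  exact bitsNat_split _ (by simp) _ _ _ _ h

/-- The sign of an integer, written only in front of negative numbers. -/
def encSign (z : ℤ) : List Token := if z < 0 then [Token.minus] else []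

theorem bitsNat_no_minus (c : Token) (hc : c ≠ Token.minus) (n : ℕ) (s t : List Token) :
    Token.minus :: s ≠ bitsNat n ++ c :: t := by
  unfold bitsNat
  cases Computability.encodeNat n with
  | nil => simpa using fun h => absurd h.symm hc
  | cons b l => simp

theorem encSign_split (c : Token) (hc : ∀ b, c ≠ Token.bit b) (hc' : c ≠ Token.minus)
    (y z : ℤ) (s t : List Token)
    (h : encSign y ++ (bitsNat y.natAbs ++ c :: s) = encSign z ++ (bitsNat z.natAbs ++ c :: t)) :
    y = z ∧ s = t := by
  unfold encSign at h
  split_ifs at h with h1 h2 h2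
  · simp only [List.singleton_append, List.cons.injEq, true_and] at h
    obtain ⟨h3, h4⟩ := bitsNat_split c hc _ _ _ _ h
    exact ⟨by omega, h4⟩
  · exact absurd h (bitsNat_no_minus c hc' _ _ _)
  · exact absurd h.symm (bitsNat_no_minus c hc' _ _ _)
  · simp only [List.nil_append] at h
    obtain ⟨h3, h4⟩ := bitsNat_split c hc _ _ _ _ h
    exact ⟨by omega, h4⟩

/-- An integer: sign and binary digits of the absolute value. -/
def encInt (z : ℤ) : List Token := encSign z ++ bitsNat z.natAbs ++ [Token.endNum]

theorem prefixInj_encInt : PrefixInj encInt := by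
  intro y z s t h
  simp only [encInt, List.append_assoc, List.singleton_append] at h
  exact encSign_split _ (by simp) (by simp) _ _ _ _ h

/-- A rational number in reduced form: sign, numerator and denominator in binary. -/
def encRat (r : ℚ) : List Token :=
  encSign r.num ++ bitsNat r.num.natAbs ++ [Token.slash] ++ bitsNat r.den ++ [Token.endNum]

theorem prefixInj_encRat : PrefixInj encRat := by
  intro r r' s t h
  simp only [encRat, List.append_assoc, List.singleton_append] at h
  obtain ⟨h1, h2⟩ := encSign_split _ (by simp) (by simp) _ _ _ _ h
  obtain ⟨h3, h4⟩ := bitsNat_split _ (by simp) _ _ _ _ h2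
  exact ⟨Rat.ext h1 h3, h4⟩

/-- A finite family of known length, written entry after entry. -/
def encFin {α : Type} (e : α → List Token) {n : ℕ} (f : Fin n → α) : List Token :=
  (List.ofFn f).flatMap e

theorem prefixInj_encFin {α : Type} {e : α → List Token} (he : PrefixInj e) (n : ℕ) :
    PrefixInj (encFin e (n := n)) := by
  induction n with
  | zero =>
    intro f g s t h
    exact ⟨Subsingleton.elim _ _, by simpa [encFin] using h⟩
  | succ n ih =>
    intro f g s t h
    simp only [encFin, List.ofFn_succ, List.flatMap_cons, List.append_assoc] at h
    obtain ⟨h1, h2⟩ := he _ _ _ _ h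
    obtain ⟨h3, h4⟩ := ih _ _ _ _ h2
    refine ⟨funext fun i => ?_, h4⟩
    refine Fin.cases h1 (fun j => congrFun h3 j) i

/-! ### Decision problems and polynomial-time many-one reductions -/

/-- A decision problem: a type of instances, each written as a string over a finite alphabet
(distinct instances being written differently), and the set of yes-instances. -/
structure DecisionProblem where
  /-- the instances -/
  Inst : Type
  /-- the alphabet -/
  Alphabet : Type
  /-- the alphabet is finite -/
  finite_alphabet : Finite Alphabet
  /-- the encoding of instances as strings -/
  encode : Inst → List Alphabet
  /-- the encoding is unambiguous -/
  encode_injective : Function.Injective encode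
  /-- the yes-instances -/
  Yes : Inst → Prop

/-- Polynomial-time many-one reducibility; the reduction is computed by a multi-stack Turing machine
whose number of steps is bounded by a polynomial in the length of the encoded input. -/
def PolyTimeReducible (P Q : DecisionProblem) : Prop :=
  ∃ f : P.Inst → Q.Inst,
    Nonempty (Turing.TM2ComputableInPolyTime P.encode Q.encode f) ∧
      ∀ x : P.Inst, P.Yes x ↔ Q.Yes (f x)

/-! ### The existential theory of the reals -/

/-- An integer polynomial in `N` variables in sparse form: a list of monomials, each given by
its coefficient and its exponent vector. -/
abbrev SparsePoly (N : ℕ) : Type := List (ℤ × (Fin N → ℕ))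

/-- The value of a sparse polynomial at a real point. -/
def SparsePoly.eval {N : ℕ} (p : SparsePoly N) (x : Fin N → ℝ) : ℝ :=
  (p.map fun c => (c.1 : ℝ) * ∏ i, x i ^ c.2 i).sum

/-- The polynomial of `ℤ[x₁, …, x_N]` that a sparse list represents. -/
noncomputable def SparsePoly.toMvPolynomial {N : ℕ} (p : SparsePoly N) :
    MvPolynomial (Fin N) ℤ :=
  (p.map fun c => MvPolynomial.monomial (Finsupp.equivFunOnFinite.symm c.2) c.1).sum

/-- The value of a sparse polynomial is the value of the polynomial that it represents. -/
theorem SparsePoly.aeval_toMvPolynomial {N : ℕ} (p : SparsePoly N) (x : Fin N → ℝ) :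
    MvPolynomial.aeval x p.toMvPolynomial = p.eval x := by
  induction p with
  | nil => simp [SparsePoly.toMvPolynomial, SparsePoly.eval]
  | cons c p ih =>
    simp only [SparsePoly.toMvPolynomial, SparsePoly.eval] at ih ⊢
    simp only [List.map_cons, List.sum_cons, map_add, ih]
    rw [MvPolynomial.aeval_monomial, Finsupp.prod_fintype _ _ (by simp)]
    simp

/-- The four kinds of atomic predicates `p = 0`, `p ≠ 0`, `p ≥ 0`, `p > 0`. -/
inductive AtomKind : Type
  | eqZero
  | neZero
  | geZero
  | gtZero

/-- The meaning of an atomic predicate for a given value of its polynomial. -/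
def AtomKind.Holds : AtomKind → ℝ → Prop
  | .eqZero, v => v = 0
  | .neZero, v => v ≠ 0
  | .geZero, v => 0 ≤ v
  | .gtZero, v => 0 < v

/-- The symbol of an atomic predicate. -/
def AtomKind.sym : AtomKind → Token
  | .eqZero => .eqZero
  | .neZero => .neZero
  | .geZero => .geZero
  | .gtZero => .gtZero

/-- Quantifier-free formulas in `N` real variables. -/
inductive QFFormula (N : ℕ) : Type
  | atom (r : AtomKind) (p : SparsePoly N)
  | conj (φ ψ : QFFormula N)
  | disj (φ ψ : QFFormula N)
  | neg (φ : QFFormula N)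

/-- Satisfaction of a quantifier-free formula at a real point. -/
def QFFormula.Sat {N : ℕ} : QFFormula N → (Fin N → ℝ) → Prop
  | .atom r p, x => r.Holds (p.eval x)
  | .conj φ ψ, x => φ.Sat x ∧ ψ.Sat x
  | .disj φ ψ, x => φ.Sat x ∨ ψ.Sat x
  | .neg φ, x => ¬ φ.Sat x

/-- A monomial: its coefficient and its exponent vector, all numbers in binary. -/
def encMonomial {N : ℕ} (c : ℤ × (Fin N → ℕ)) : List Token :=
  encInt c.1 ++ encFin encNat c.2

theorem prefixInj_encMonomial (N : ℕ) : PrefixInj (encMonomial (N := N)) := by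
  intro c d s t h
  simp only [encMonomial, List.append_assoc] at h
  obtain ⟨h1, h2⟩ := prefixInj_encInt _ _ _ _ h
  obtain ⟨h3, h4⟩ := prefixInj_encFin prefixInj_encNat N _ _ _ _ h2
  exact ⟨Prod.ext h1 h3, h4⟩

/-- A sparse polynomial: the list of its monomials. -/
def encPoly {N : ℕ} (p : SparsePoly N) : List Token :=
  (p.flatMap fun c => Token.monomial :: encMonomial c) ++ [Token.endPoly]

theorem prefixInj_encPoly (N : ℕ) : PrefixInj (encPoly (N := N)) := by
  intro p
  induction p with
  | nil =>
    intro p' s t h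
    cases p' with
    | nil => simpa [encPoly] using h
    | cons d p' => simp [encPoly] at h
  | cons c p ih =>
    intro p' s t h
    cases p' with
    | nil => simp [encPoly] at h
    | cons d p' =>
      simp only [encPoly, List.flatMap_cons, List.cons_append, List.append_assoc,
        List.cons.injEq, true_and] at h
      obtain ⟨h1, h2⟩ := prefixInj_encMonomial N _ _ _ _ h
      obtain ⟨h3, h4⟩ := ih p' s t (by simpa [encPoly] using h2)
      exact ⟨by rw [h1, h3], h4⟩

/-- A quantifier-free formula, in prefix notation. -/
def QFFormula.encode {N : ℕ} : QFFormula N → List Token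
  | .atom r p => r.sym :: encPoly p
  | .conj φ ψ => Token.conj :: (φ.encode ++ ψ.encode)
  | .disj φ ψ => Token.disj :: (φ.encode ++ ψ.encode)
  | .neg φ => Token.neg :: φ.encode

theorem prefixInj_encodeFormula (N : ℕ) : PrefixInj (QFFormula.encode (N := N)) := by
  intro φ
  induction φ with
  | atom r p =>
    intro φ' s t h
    cases φ' with
    | atom r' p' =>
      simp only [QFFormula.encode, List.cons_append, List.cons.injEq] at h
      obtain ⟨h1, h2⟩ := prefixInj_encPoly N _ _ _ _ h.2
      have h3 : r = r' := by
        have h4 := h.1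
        cases r <;> cases r' <;> simp [AtomKind.sym] at h4 ⊢
      exact ⟨by rw [h1, h3], h2⟩
    | conj _ _ => cases r <;> simp [QFFormula.encode, AtomKind.sym] at h
    | disj _ _ => cases r <;> simp [QFFormula.encode, AtomKind.sym] at h
    | neg _ => cases r <;> simp [QFFormula.encode, AtomKind.sym] at h
  | conj φ ψ ih1 ih2 =>
    intro φ' s t h
    cases φ' with
    | atom r' _ => cases r' <;> simp [QFFormula.encode, AtomKind.sym] at h
    | conj φ' ψ' =>
      simp only [QFFormula.encode, List.cons_append, List.append_assoc, List.cons.injEq,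
        true_and] at h
      obtain ⟨h1, h2⟩ := ih1 _ _ _ h
      obtain ⟨h3, h4⟩ := ih2 _ _ _ h2
      exact ⟨by rw [h1, h3], h4⟩
    | disj _ _ => simp [QFFormula.encode] at h
    | neg _ => simp [QFFormula.encode] at h
  | disj φ ψ ih1 ih2 =>
    intro φ' s t h
    cases φ' with
    | atom r' _ => cases r' <;> simp [QFFormula.encode, AtomKind.sym] at h
    | disj φ' ψ' =>
      simp only [QFFormula.encode, List.cons_append, List.append_assoc, List.cons.injEq,
        true_and] at h
      obtain ⟨h1, h2⟩ := ih1 _ _ _ h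
      obtain ⟨h3, h4⟩ := ih2 _ _ _ h2
      exact ⟨by rw [h1, h3], h4⟩
    | conj _ _ => simp [QFFormula.encode] at h
    | neg _ => simp [QFFormula.encode] at h
  | neg φ ih =>
    intro φ' s t h
    cases φ' with
    | atom r' _ => cases r' <;> simp [QFFormula.encode, AtomKind.sym] at h
    | neg φ' =>
      simp only [QFFormula.encode, List.cons_append, List.cons.injEq, true_and] at h
      obtain ⟨h1, h2⟩ := ih _ _ _ h
      exact ⟨by rw [h1], h2⟩
    | conj _ _ => simp [QFFormula.encode] at h
    | disj _ _ => simp [QFFormula.encode] at h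

/-- A sentence `∃ x ∈ ℝᴺ, φ(x)` with quantifier-free `φ`. -/
structure ETRSentence : Type where
  /-- the number of variables -/
  N : ℕ
  /-- the quantifier-free part -/
  φ : QFFormula N

/-- Truth of an existential sentence over the reals. -/
def ETRSentence.IsTrue (S : ETRSentence) : Prop := ∃ x : Fin S.N → ℝ, S.φ.Sat x

/-- A sentence: one quantifier symbol for each variable, then the formula. -/
def ETRSentence.encode (S : ETRSentence) : List Token :=
  List.replicate S.N Token.ex ++ S.φ.encode

theorem QFFormula.encode_no_ex {N : ℕ} (φ : QFFormula N) (s : List Token) :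
    φ.encode ≠ Token.ex :: s := by
  cases φ with
  | atom r p => cases r <;> simp [QFFormula.encode, AtomKind.sym]
  | conj _ _ => simp [QFFormula.encode]
  | disj _ _ => simp [QFFormula.encode]
  | neg _ => simp [QFFormula.encode]

theorem ETRSentence.encode_injective : Function.Injective ETRSentence.encode := by
  have key : ∀ (M N : ℕ) (u v : List Token), (∀ s, u ≠ Token.ex :: s) → (∀ s, v ≠ Token.ex :: s) →
      List.replicate M Token.ex ++ u = List.replicate N Token.ex ++ v → M = N ∧ u = v := by
    intro M
    induction M with
    | zero =>
      intro N u v hu hv h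
      cases N with
      | zero => simpa using h
      | succ N => exact absurd (by simpa [List.replicate_succ] using h) (hu _)
    | succ M ih =>
      intro N u v hu hv h
      cases N with
      | zero => exact absurd (by simpa [List.replicate_succ] using h.symm) (hv _)
      | succ N =>
        simp only [List.replicate_succ, List.cons_append, List.cons.injEq, true_and] at h
        obtain ⟨h1, h2⟩ := ih N u v hu hv h
        exact ⟨by rw [h1], h2⟩
  rintro ⟨M, φ⟩ ⟨N, ψ⟩ h
  obtain ⟨h1, h2⟩ := key M N _ _ φ.encode_no_ex ψ.encode_no_ex h
  subst h1
  rw [(prefixInj_encodeFormula M).injective h2]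

/-- The decision problem ETR. -/
def ETR : DecisionProblem where
  Inst := ETRSentence
  Alphabet := Token
  finite_alphabet := inferInstance
  encode := ETRSentence.encode
  encode_injective := ETRSentence.encode_injective
  Yes := ETRSentence.IsTrue

/-- The complexity class `∃ℝ`: the decision problems that are polynomial-time many-one reducible
to ETR. -/
def ExistsR : Set DecisionProblem := {P | PolyTimeReducible P ETR}

/-! ### Affine rank minimization -/

/-- The Frobenius inner product of a rational matrix with a real matrix. -/
def frobeniusInner {m n : ℕ} (A : Matrix (Fin m) (Fin n) ℚ) (X : Matrix (Fin m) (Fin n) ℝ) : ℝ :=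
  ∑ i, ∑ j, (A i j : ℝ) * X i j

/-- The input of affine rank minimization. -/
structure ARMInstance : Type where
  /-- the number of rows -/
  m : ℕ
  /-- the number of columns -/
  n : ℕ
  /-- the number of affine constraints -/
  q : ℕ
  /-- the constraint matrices -/
  A : Fin q → Matrix (Fin m) (Fin n) ℚ
  /-- the right-hand sides -/
  b : Fin q → ℚ

/-- Some real matrix of rank at most `k` satisfies all the affine constraints. -/
def ARMInstance.Feasible (k : ℕ) (I : ARMInstance) : Prop :=
  ∃ X : Matrix (Fin I.m) (Fin I.n) ℝ, (∀ l, frobeniusInner (I.A l) X = I.b l) ∧ X.rank ≤ k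

/-- A row of a constraint matrix. -/
def encRow {n : ℕ} (r : Fin n → ℚ) : List Token := Token.row :: encFin encRat r

/-- One affine constraint: the matrix, row by row, and the right-hand side. -/
def encConstraint {m n : ℕ} (c : (Fin m → Fin n → ℚ) × ℚ) : List Token :=
  Token.matrix :: (encFin encRow c.1 ++ Token.rhs :: encRat c.2)

theorem prefixInj_encRow (n : ℕ) : PrefixInj (encRow (n := n)) := by
  intro r r' s t h
  simp only [encRow, List.cons_append, List.cons.injEq, true_and] at h
  exact prefixInj_encFin prefixInj_encRat n _ _ _ _ h

theorem prefixInj_encConstraint (m n : ℕ) : PrefixInj (encConstraint (m := m) (n := n)) := by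
  intro c d s t h
  simp only [encConstraint, List.cons_append, List.append_assoc, List.cons.injEq,
    true_and] at h
  obtain ⟨h1, h2⟩ := prefixInj_encFin (prefixInj_encRow n) m _ _ _ _ h
  simp only [List.cons.injEq, true_and] at h2
  obtain ⟨h3, h4⟩ := prefixInj_encRat _ _ _ _ h2
  exact ⟨Prod.ext h1 h3, h4⟩

/-- An instance: `m`, `n`, `q` in binary, then the `q` affine constraints. -/
def ARMInstance.encode (I : ARMInstance) : List Token :=
  encNat I.m ++ encNat I.n ++ encNat I.q ++
    encFin encConstraint fun l => ((fun i j => I.A l i j), I.b l)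

theorem ARMInstance.encode_injective : Function.Injective ARMInstance.encode := by
  rintro ⟨m, n, q, A, b⟩ ⟨m', n', q', A', b'⟩ h
  simp only [ARMInstance.encode, List.append_assoc] at h
  obtain ⟨h1, h2⟩ := prefixInj_encNat _ _ _ _ h
  obtain ⟨h3, h4⟩ := prefixInj_encNat _ _ _ _ h2
  obtain ⟨h5, h6⟩ := prefixInj_encNat _ _ _ _ h4
  subst h1 h3 h5
  have h7 := (prefixInj_encFin (prefixInj_encConstraint m n) q).injective h6
  have hA : A = A' := funext fun l => congrArg Prod.fst (congrFun h7 l)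
  have hb : b = b' := funext fun l => congrArg Prod.snd (congrFun h7 l)
  rw [hA, hb]

/-- The decision problem `ARM(k)`. -/
def ARM (k : ℕ) : DecisionProblem where
  Inst := ARMInstance
  Alphabet := Token
  finite_alphabet := inferInstance
  encode := ARMInstance.encode
  encode_injective := ARMInstance.encode_injective
  Yes := ARMInstance.Feasible k

/-!
A matrix of rank at most `k` is a product `U * V` through `ℝᵏ`, so an instance asks for a real
solution of polynomial equations in the entries of `U` and `V`. Two devices make these equations
easy to write down for a machine. A rational number `a` enters through an auxiliary variable `R`
with `a.num - a.den * R = 0`, so that its digits are copied from the input; and each inner product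
is accumulated entry by entry in auxiliary variables, so that every equation has boundedly many
monomials, each with boundedly many variables. With `L` cells of variables, where `L` is the length
of the input, the exponent vector of such a monomial is written by sweeping once over a ruler of
length `L` with a marker for each cell that occurs. The markers move only when a symbol of the input
is read, so a finite control with this ruler computes the reduction in quadratic time.
-/

theorem rank_le_iff_exists_mul {K m n : Type*} [Field K] [Fintype n] (k : ℕ) (X : Matrix m n K) :
    X.rank ≤ k ↔ ∃ (U : Matrix m (Fin k) K) (V : Matrix (Fin k) n K), X = U * V := by
  classical
  constructor
  · intro h
    have hrange : Module.finrank K (LinearMap.range X.mulVecLin) ≤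
        Module.finrank K (Fin k → K) := by
      simpa [Matrix.rank] using h
    obtain ⟨f, hf⟩ := finrank_le_iff_exists_linearMap.1 hrange
    obtain ⟨g, hg⟩ := f.exists_leftInverse_of_injective (LinearMap.ker_eq_bot.2 hf)
    refine ⟨LinearMap.toMatrix' ((LinearMap.range X.mulVecLin).subtype ∘ₗ g),
      LinearMap.toMatrix' (f ∘ₗ X.mulVecLin.rangeRestrict), ?_⟩
    rw [← LinearMap.toMatrix'_comp, LinearMap.comp_assoc, ← LinearMap.comp_assoc _ f g, hg,
      LinearMap.id_comp, LinearMap.subtype_comp_codRestrict, ← Matrix.toLin'_apply',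
      LinearMap.toMatrix'_toLin']
  · rintro ⟨U, V, rfl⟩
    exact (Matrix.rank_mul_le_left U V).trans (U.rank_le_card_width.trans_eq (Fintype.card_fin k))

/-! ### Stack machines -/

section ListTransducers

variable {σ α β : Type*}

/-- The run of a deterministic transducer with transition function `f` from the state `s`: the
state that it reaches and the word that it writes. -/
def transduce (f : σ → α → σ × List β) : σ → List α → σ × List β
  | s, [] => (s, [])
  | s, a :: l => ((transduce f (f s a).1 l).1, (f s a).2 ++ (transduce f (f s a).1 l).2)

theorem transduce_append (f : σ → α → σ × List β) (s : σ) (l₁ l₂ : List α) :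
    transduce f s (l₁ ++ l₂) = ((transduce f (transduce f s l₁).1 l₂).1,
      (transduce f s l₁).2 ++ (transduce f (transduce f s l₁).1 l₂).2) := by
  induction l₁ generalizing s with
  | nil => rfl
  | cons a l₁ ih => simp only [List.cons_append, transduce, ih, List.append_assoc]

end ListTransducers

/-- A machine with the stacks `K`, where `Γ k` is the alphabet of the stack `k`. In the state `ℓ`
it pops the stack `source ℓ`; the symbol found (`none` on the empty stack) determines the words to
be pushed, whose heads become the new tops, and the next state (`none` to halt). -/
structure StackMachine (K : Type) (Γ : K → Type) (Λ : Type) where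
  /-- The stack that is popped in a state. -/
  source : Λ → K
  /-- The next state and the words to be pushed. -/
  act : (ℓ : Λ) → Option (Γ (source ℓ)) → Option Λ × (∀ k, List (Γ k))

namespace StackMachine

open Turing

variable {K : Type} {Γ : K → Type} {Λ : Type} [DecidableEq K]

section Semantics

/-- The configuration after one step from the state `ℓ` with the stacks `S`. -/
def next (M : StackMachine K Γ Λ) (ℓ : Λ) (S : ∀ k, List (Γ k)) :
    Option Λ × (∀ k, List (Γ k)) :=
  ((M.act ℓ (S (M.source ℓ)).head?).1, fun k => (M.act ℓ (S (M.source ℓ)).head?).2 k ++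
    Function.update S (M.source ℓ) (S (M.source ℓ)).tail k)

/-- Reachability of configurations in at most the given number of steps. -/
inductive Reaches (M : StackMachine K Γ Λ) :
    ℕ → Option Λ × (∀ k, List (Γ k)) → Option Λ × (∀ k, List (Γ k)) → Prop
  | refl (n : ℕ) (c) : Reaches M n c c
  | head {n : ℕ} {ℓ : Λ} {S : ∀ k, List (Γ k)} {c} :
      Reaches M n (M.next ℓ S) c → Reaches M (n + 1) (some ℓ, S) c

variable {M : StackMachine K Γ Λ} {m n : ℕ} {c d e : Option Λ × (∀ k, List (Γ k))}

theorem Reaches.mono (h : M.Reaches m c d) (hmn : m ≤ n) : M.Reaches n c d := by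
  induction h generalizing n with
  | refl m c => exact .refl n c
  | head _ ih =>
    obtain ⟨n, rfl⟩ := Nat.exists_eq_succ_of_ne_zero (by omega : n ≠ 0)
    exact .head (ih (Nat.le_of_succ_le_succ hmn))

theorem Reaches.trans (h₁ : M.Reaches m c d) (h₂ : M.Reaches n d e) :
    M.Reaches (m + n) c e := by
  induction h₁ with
  | refl m d => exact h₂.mono (Nat.le_add_left n m)
  | @head m ℓ S d _ ih => exact Nat.succ_add m n ▸ .head (ih h₂)

theorem Reaches.of_next_eq {ℓ : Λ} {S : ∀ k, List (Γ k)} (hnext : M.next ℓ S = c)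
    (h : M.Reaches n c d) : M.Reaches (n + 1) (some ℓ, S) d :=
  .head (hnext ▸ h)

theorem exists_length_stack_le [Finite K] [∀ k, Finite (Γ k)] [Finite Λ]
    (M : StackMachine K Γ Λ) : ∃ B : ℕ, ∀ {n c d}, M.Reaches n c d →
      ∀ k, (d.2 k).length ≤ (c.2 k).length + B * n := by
  obtain ⟨B, hB⟩ := Finite.exists_le fun p : (Σ ℓ, Option (Γ (M.source ℓ))) × K =>
    ((M.act p.1.1 p.1.2).2 p.2).length
  refine ⟨B, fun h k => ?_⟩
  induction h with
  | refl n c => exact Nat.le_add_right _ _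
  | @head n ℓ S d _ ih =>
    have hpush := hB (⟨ℓ, (S (M.source ℓ)).head?⟩, k)
    have hpop : (Function.update S (M.source ℓ) (S (M.source ℓ)).tail k).length ≤
        (S k).length := by
      obtain rfl | hk := eq_or_ne k (M.source ℓ)
      · simp
      · simp [hk]
    simp only [next, List.length_append] at ih hpush ⊢
    rw [Nat.mul_succ]
    omega

end Semantics

theorem tm2OutputsInTime_eq (tm : FinTM2) (l : List (tm.Γ tm.k₀)) (l' : List (tm.Γ tm.k₁))
    (n : ℕ) : TM2OutputsInTime tm l (some l') n = StateTransition.EvalsToInTime tm.step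
      ⟨some tm.main, tm.initialState, Function.update (fun _ => []) tm.k₀ l⟩
      (some ⟨none, tm.initialState, Function.update (fun _ => []) tm.k₁ l'⟩) n := by
  have hstack (k₀ : tm.K) (l : List (tm.Γ k₀)) : (fun k => if h : k = k₀ then by rw [h]; exact l
      else []) = Function.update (fun _ => []) k₀ l := by
    funext k
    obtain rfl | hk := eq_or_ne k k₀
    · simp
    · simp [hk]
  rw [← hstack, ← hstack]
  rfl

section Compilation

/-- The control register of the compiled machine: the symbol popped last, if any. -/
abbrev Register (Γ : K → Type) : Type := Option (Σ k, Γ k)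

section BranchOn

variable {ι : Type} [Fintype ι]

open Classical in
/-- The statement that continues with `F i` if the register contains `g i`. -/
noncomputable def branchOn (g : ι → Register Γ) (F : ι → TM2.Stmt Γ Λ (Register Γ)) :
    TM2.Stmt Γ Λ (Register Γ) :=
  Finset.univ.toList.foldr (fun i q => .branch (fun v => decide (v = g i)) (F i) q) .halt

theorem stepAux_branchOn {g : ι → Register Γ} (hg : g.Injective)
    (F : ι → TM2.Stmt Γ Λ (Register Γ)) (i : ι) (S : ∀ k, List (Γ k)) :
    TM2.stepAux (branchOn g F) (g i) S = TM2.stepAux (F i) (g i) S := by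
  have hi : i ∈ (Finset.univ : Finset ι).toList := by simp
  unfold branchOn
  generalize (Finset.univ : Finset ι).toList = l at hi
  induction l with
  | nil => simp at hi
  | cons j l ih =>
    obtain rfl | hij := eq_or_ne i j
    · simp [TM2.stepAux]
    · simpa [TM2.stepAux, hg.ne hij] using ih ((List.mem_cons.1 hi).resolve_left hij)

end BranchOn

/-- The statement that pushes the word `w` on the stack `k` and continues with `q`. -/
def pushWord (k : K) (w : List (Γ k)) (q : TM2.Stmt Γ Λ (Register Γ)) :
    TM2.Stmt Γ Λ (Register Γ) :=
  w.foldl (fun q a => .push k (fun _ => a) q) q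

theorem stepAux_pushWord (k : K) (w : List (Γ k)) (q : TM2.Stmt Γ Λ (Register Γ))
    (v : Register Γ) (S : ∀ k, List (Γ k)) : TM2.stepAux (pushWord k w q) v S =
      TM2.stepAux q v (Function.update S k (w ++ S k)) := by
  induction w generalizing q with
  | nil => simp [pushWord]
  | cons a w ih => simpa [pushWord, TM2.stepAux] using ih (.push k (fun _ => a) q)

variable [Fintype K]

/-- The statement that pushes the word `W k` on every stack `k` and continues with `q`. -/
noncomputable def pushWords (W : ∀ k, List (Γ k)) (q : TM2.Stmt Γ Λ (Register Γ)) :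
    TM2.Stmt Γ Λ (Register Γ) :=
  Finset.univ.toList.foldr (fun k q => pushWord k (W k) q) q

theorem stepAux_pushWords (W : ∀ k, List (Γ k)) (q : TM2.Stmt Γ Λ (Register Γ))
    (v : Register Γ) (S : ∀ k, List (Γ k)) :
    TM2.stepAux (pushWords W q) v S = TM2.stepAux q v fun k => W k ++ S k := by
  have key : ∀ l : List K, l.Nodup → ∀ S : ∀ k, List (Γ k),
      TM2.stepAux (l.foldr (fun k q => pushWord k (W k) q) q) v S =
        TM2.stepAux q v fun k => if k ∈ l then W k ++ S k else S k := by
    intro l hl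
    induction hl with
    | nil => simp
    | @cons k l hk _ ih =>
      intro S
      rw [List.foldr_cons, stepAux_pushWord, ih]
      congr 1
      funext j
      obtain rfl | hjk := eq_or_ne j k
      · have hjl : j ∉ l := fun h => hk j h rfl
        simp [hjl]
      · simp [hjk]
  rw [pushWords, key _ (Finset.nodup_toList _)]
  simp only [Finset.mem_toList, Finset.mem_univ, if_true]

variable [∀ k, Fintype (Γ k)]

/-- The code of a state: after the pushes the register is emptied again. -/
noncomputable def program (M : StackMachine K Γ Λ) (ℓ : Λ) : TM2.Stmt Γ Λ (Register Γ) :=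
  .pop (M.source ℓ) (fun _ a => a.map (Sigma.mk _)) <|
    branchOn (ι := Option (Γ (M.source ℓ))) (Option.map (Sigma.mk _)) fun a =>
      pushWords (M.act ℓ a).2 <| .load (fun _ => none) <|
        (M.act ℓ a).1.elim .halt fun ℓ' => .goto fun _ => ℓ'

theorem step_program (M : StackMachine K Γ Λ) (ℓ : Λ) (S : ∀ k, List (Γ k)) :
    TM2.step M.program ⟨some ℓ, none, S⟩ = some ⟨(M.next ℓ S).1, none, (M.next ℓ S).2⟩ := by
  have hinj : (Option.map (Sigma.mk (β := Γ) (M.source ℓ))).Injective :=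
    Option.map_injective sigma_mk_injective
  simp only [TM2.step, program, TM2.stepAux, stepAux_branchOn hinj, stepAux_pushWords, next]
  cases (M.act ℓ (S (M.source ℓ)).head?).1 <;> rfl

theorem Reaches.nonempty_evalsToInTime {M : StackMachine K Γ Λ} {n : ℕ}
    {c d : Option Λ × (∀ k, List (Γ k))} (h : M.Reaches n c d) :
    Nonempty (StateTransition.EvalsToInTime (TM2.step M.program) ⟨c.1, none, c.2⟩
      (some ⟨d.1, none, d.2⟩) n) := by
  induction h with
  | refl n c => exact ⟨⟨⟨0, rfl⟩, n.zero_le⟩⟩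
  | @head n ℓ S d _ ih =>
    obtain ⟨⟨steps, hsteps⟩, hle⟩ := ih
    refine ⟨⟨⟨steps + 1, ?_⟩, Nat.succ_le_succ hle⟩⟩
    rw [Function.iterate_succ_apply, ← hsteps]
    exact congrArg _ (M.step_program ℓ S)

/-- The compiled machine, started in the state `main`. -/
noncomputable def toFinTM2 [Fintype Λ] (M : StackMachine K Γ Λ) (input output : K) (main : Λ) :
    FinTM2 where
  k₀ := input
  k₁ := output
  Γ := Γ
  Λ := Λ
  σ := Register Γ
  main := main
  initialState := none
  m := M.program

end Compilation

theorem nonempty_tm2ComputableInPolyTime [Finite K] [∀ k, Finite (Γ k)] [Finite Λ]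
    (M : StackMachine K Γ Λ) {input output : K} (main : Λ) {A B : Type} {ea : A → List (Γ input)}
    {eb : B → List (Γ output)} {f : A → B} (p : Polynomial ℕ)
    (h : ∀ x, M.Reaches (p.eval (ea x).length)
      (some main, Function.update (fun _ => []) input (ea x))
      (none, Function.update (fun _ => []) output (eb (f x)))) :
    Nonempty (TM2ComputableInPolyTime ea eb f) := by
  have := Fintype.ofFinite K
  have (k : K) := Fintype.ofFinite (Γ k)
  have := Fintype.ofFinite Λ
  have outputs x : TM2OutputsInTime (M.toFinTM2 input output main) (ea x) (some (eb (f x)))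
      (p.eval (ea x).length) :=
    cast (tm2OutputsInTime_eq _ _ _ _).symm (h x).nonempty_evalsToInTime.some
  refine ⟨⟨⟨M.toFinTM2 input output main, .refl _, .refl _⟩, p, fun x => ?_⟩⟩
  exact cast (by congr 2 <;> exact (List.map_id _).symm) (outputs x)

end StackMachine

/-! ### Transducers with a ruler -/

/-- A transducer with a ruler, that is, a list of as many cells as the input has symbols. Reading
a symbol produces a list of commands; a command writes a fixed word and then sweeps a Mealy machine
with the states `C` once over the ruler, which rewrites the cells and writes further words. -/
structure SweepTransducer (α β Q D C X : Type) where
  /-- The initial state. -/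
  start : Q
  /-- The commands that are executed before the input is read. -/
  initial : List D
  /-- The next state and the commands to be executed upon reading a symbol. -/
  next : Q → α → Q × List D
  /-- The word that a command writes before its sweep. -/
  word : D → List β
  /-- The state in which a command starts its sweep. -/
  carry : D → C
  /-- The next state, the new cell and the word to be written when a sweep visits a cell. -/
  sweep : D → C → X → C × X × List β
  /-- The initial value of all cells. -/
  blank : X
  /-- The word that is written at the end. -/
  final : List β

namespace SweepTransducer

variable {α β Q D C X : Type} (T : SweepTransducer α β Q D C X)

/-- The new ruler and the word written by a sweep for the command `d` in the state `c`. -/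
def pass (d : D) (c : C) : List X → List X × List β
  | [] => ([], [])
  | x :: r => ((T.sweep d c x).2.1 :: (pass d (T.sweep d c x).1 r).1,
      (T.sweep d c x).2.2 ++ (pass d (T.sweep d c x).1 r).2)

/-- The new ruler and the word written by the command `d` with the ruler `r`. -/
def exec (r : List X) (d : D) : List X × List β :=
  ((T.pass d (T.carry d) r).1, T.word d ++ (T.pass d (T.carry d) r).2)

/-- The effect of reading the symbol `a` on state and ruler, and the word written thereby. -/
def read (s : Q × List X) (a : α) : (Q × List X) × List β :=
  (((T.next s.1 a).1, (transduce T.exec s.2 (T.next s.1 a).2).1),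
    (transduce T.exec s.2 (T.next s.1 a).2).2)

/-- The ruler when the input is about to be read, and the word written so far. -/
def setup (n : ℕ) : List X × List β :=
  transduce T.exec (List.replicate n T.blank) T.initial

/-- The word that the transducer writes for the input `l`. -/
def output (l : List α) : List β :=
  (T.setup l.length).2 ++ (transduce T.read (T.start, (T.setup l.length).1) l).2 ++ T.final

@[simp]
theorem length_pass (d : D) (c : C) (r : List X) : (T.pass d c r).1.length = r.length := by
  induction r generalizing c with
  | nil => rfl
  | cons x r ih => simp [pass, ih]

@[simp]
theorem length_transduce_exec (r : List X) (l : List D) :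
    (transduce T.exec r l).1.length = r.length := by
  induction l generalizing r with
  | nil => rfl
  | cons d l ih => simp [transduce, exec, ih]

theorem length_transduce_read (s : Q × List X) (l : List α) :
    (transduce T.read s l).1.2.length = s.2.length := by
  induction l generalizing s with
  | nil => rfl
  | cons a l ih => simp [transduce, read, ih]

section Machine

/-- The stacks of the machine for a sweep transducer: `tmp` holds the input while the ruler is laid
out, `cmd` the pending commands, `swept` the cells that the sweep has passed in reverse order, and
`out` the word written so far in reverse order. -/
inductive StackName : Type
  | input | tmp | cmd | ruler | swept | out | output
  deriving DecidableEq

instance : Fintype StackName :=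
  ⟨{.input, .tmp, .cmd, .ruler, .swept, .out, .output}, fun s => by cases s <;> simp⟩

/-- The stack alphabets. -/
abbrev StackName.Symbol (α β D X : Type) : StackName → Type
  | input | tmp => α
  | cmd => D
  | ruler | swept => X
  | out | output => β

/-- The states of the machine for a sweep transducer: the ruler is laid out in `measure` and
`restore`, the commands are executed in `fetch`, `sweep` and `rewind`, and the word written is
brought into the right order in `emit`. -/
inductive Label (Q D C : Type) : Type
  | measure
  | restore
  | read (q : Q)
  | fetch (q : Q)
  | sweep (q : Q) (d : D) (c : C)
  | rewind (q : Q)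
  | emit
  | clear
  deriving Fintype

/-- The contents of all stacks. -/
structure Store (α β D X : Type) : Type where
  input : List α := []
  tmp : List α := []
  cmd : List D := []
  ruler : List X := []
  swept : List X := []
  out : List β := []
  output : List β := []

/-- The contents of all stacks as a family. -/
def Store.stack (S : Store α β D X) : ∀ s : StackName, List (s.Symbol α β D X)
  | .input => S.input
  | .tmp => S.tmp
  | .cmd => S.cmd
  | .ruler => S.ruler
  | .swept => S.swept
  | .out => S.out
  | .output => S.output

/-- The machine that computes the function `T.output`. -/
def machine : StackMachine StackName (StackName.Symbol α β D X) (Label Q D C) where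
  source
    | .measure | .read _ => .input
    | .restore => .tmp
    | .fetch _ => .cmd
    | .sweep .. | .clear => .ruler
    | .rewind _ => .swept
    | .emit => .out
  act
    | .measure => fun
      | some a => (some .measure, Store.stack { tmp := [a], ruler := [T.blank] })
      | none => (some .restore, Store.stack { cmd := T.initial })
    | .restore => fun
      | some a => (some .restore, Store.stack { input := [a] })
      | none => (some (.fetch T.start), Store.stack {})
    | .read q => fun
      | some a => (some (.fetch (T.next q a).1), Store.stack { cmd := (T.next q a).2 })
      | none => (some .emit, Store.stack { out := T.final.reverse })
    | .fetch q => fun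
      | some d => (some (.sweep q d (T.carry d)), Store.stack { out := (T.word d).reverse })
      | none => (some (.read q), Store.stack {})
    | .sweep q d c => fun
      | some x => (some (.sweep q d (T.sweep d c x).1), Store.stack
          { swept := [(T.sweep d c x).2.1], out := (T.sweep d c x).2.2.reverse })
      | none => (some (.rewind q), Store.stack {})
    | .rewind q => fun
      | some x => (some (.rewind q), Store.stack { ruler := [x] })
      | none => (some (.fetch q), Store.stack {})
    | .emit => fun
      | some b => (some .emit, Store.stack { output := [b] })
      | none => (some .clear, Store.stack {})
    | .clear => fun
      | some _ => (some .clear, Store.stack {})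
      | none => (none, Store.stack {})

/-- The configuration of the machine with the state `ℓ` and the stacks `S`. -/
abbrev config (ℓ : Option (Label Q D C)) (S : Store α β D X) :
    Option (Label Q D C) × (∀ s : StackName, List (s.Symbol α β D X)) :=
  (ℓ, S.stack)

open StackMachine

variable {T}

theorem next_eq {ℓ : Label Q D C} {S : Store α β D X} {ℓ' : Option (Label Q D C)}
    {S' : Store α β D X} (hlabel : (T.machine.next ℓ S.stack).1 = ℓ')
    (hstack : ∀ s, (T.machine.next ℓ S.stack).2 s = S'.stack s) :
    T.machine.next ℓ S.stack = config ℓ' S' :=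
  Prod.ext hlabel (funext hstack)

theorem reaches_measure (l l' : List α) (r : List X) : T.machine.Reaches (l.length + 1)
    (config (some .measure) { input := l, tmp := l', ruler := r })
    (config (some .restore) { tmp := l.reverse ++ l', cmd := T.initial,
                              ruler := List.replicate l.length T.blank ++ r }) := by
  induction l generalizing l' r with
  | nil =>
    refine .of_next_eq (next_eq rfl fun s => ?_) (.refl _ _)
    cases s
    case cmd => exact List.append_nil _
    all_goals rfl
  | cons a l ih =>
    have h := ih (a :: l') (T.blank :: r)
    rw [List.append_cons, ← List.reverse_cons, List.append_cons, ← List.replicate_succ'] at h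
    exact .of_next_eq (next_eq rfl fun s => by cases s <;> rfl) h

theorem reaches_restore (l l' : List α) (ds : List D) (r : List X) :
    T.machine.Reaches (l'.length + 1)
      (config (some .restore) { input := l, tmp := l', cmd := ds, ruler := r })
      (config (some (.fetch T.start)) { input := l'.reverse ++ l, cmd := ds, ruler := r }) := by
  induction l' generalizing l with
  | nil => exact .of_next_eq (next_eq rfl fun s => by cases s <;> rfl) (.refl _ _)
  | cons a l' ih =>
    have h := ih (a :: l)
    rw [List.append_cons, ← List.reverse_cons] at h
    exact .of_next_eq (next_eq rfl fun s => by cases s <;> rfl) h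

theorem reaches_sweep (l : List α) (ds : List D) (q : Q) (d : D) (c : C) (r r' : List X)
    (o : List β) : T.machine.Reaches (r.length + 1)
      (config (some (.sweep q d c)) { input := l, cmd := ds, ruler := r, swept := r', out := o })
      (config (some (.rewind q)) { input := l, cmd := ds, swept := (T.pass d c r).1.reverse ++ r',
                                   out := (T.pass d c r).2.reverse ++ o }) := by
  induction r generalizing c r' o with
  | nil => exact .of_next_eq (next_eq rfl fun s => by cases s <;> rfl) (.refl _ _)
  | cons x r ih =>
    have h := ih (T.sweep d c x).1 ((T.sweep d c x).2.1 :: r') ((T.sweep d c x).2.2.reverse ++ o)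
    rw [List.append_cons, ← List.reverse_cons, ← List.append_assoc, ← List.reverse_append] at h
    exact .of_next_eq (next_eq rfl fun s => by cases s <;> rfl) h

theorem reaches_rewind (l : List α) (ds : List D) (q : Q) (r r' : List X) (o : List β) :
    T.machine.Reaches (r'.length + 1)
      (config (some (.rewind q)) { input := l, cmd := ds, ruler := r, swept := r', out := o })
      (config (some (.fetch q)) { input := l, cmd := ds, ruler := r'.reverse ++ r, out := o }) := by
  induction r' generalizing r with
  | nil => exact .of_next_eq (next_eq rfl fun s => by cases s <;> rfl) (.refl _ _)
  | cons x r' ih =>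
    have h := ih (x :: r)
    rw [List.append_cons, ← List.reverse_cons] at h
    exact .of_next_eq (next_eq rfl fun s => by cases s <;> rfl) h

theorem reaches_exec (l : List α) (ds : List D) (q : Q) (d : D) (r : List X) (o : List β) :
    T.machine.Reaches (2 * r.length + 3)
      (config (some (.fetch q)) { input := l, cmd := d :: ds, ruler := r, out := o })
      (config (some (.fetch q)) { input := l, cmd := ds, ruler := (T.exec r d).1,
                                  out := (T.exec r d).2.reverse ++ o }) := by
  have hsweep := reaches_sweep (T := T) l ds q d (T.carry d) r [] ((T.word d).reverse ++ o)
  have hrewind := reaches_rewind (T := T) l ds q [] (T.pass d (T.carry d) r).1.reverse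
    ((T.pass d (T.carry d) r).2.reverse ++ ((T.word d).reverse ++ o))
  rw [List.append_nil] at hsweep hrewind
  rw [List.reverse_reverse, List.length_reverse, length_pass, ← List.append_assoc,
    ← List.reverse_append] at hrewind
  rw [← List.append_assoc, ← List.reverse_append] at hsweep
  exact (Reaches.of_next_eq (next_eq rfl fun s => by cases s <;> rfl)
    (hsweep.trans hrewind)).mono (by omega)

theorem reaches_execAll (l : List α) (ds : List D) (q : Q) (r : List X) (o : List β) :
    T.machine.Reaches (ds.length * (2 * r.length + 3) + 1)
      (config (some (.fetch q)) { input := l, cmd := ds, ruler := r, out := o })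
      (config (some (.read q)) { input := l, ruler := (transduce T.exec r ds).1,
                                 out := (transduce T.exec r ds).2.reverse ++ o }) := by
  induction ds generalizing r o with
  | nil => exact .of_next_eq (next_eq rfl fun s => by cases s <;> rfl) (.refl _ _)
  | cons d ds ih =>
    have h := ih (T.exec r d).1 ((T.exec r d).2.reverse ++ o)
    rw [← List.append_assoc, ← List.reverse_append] at h
    refine ((reaches_exec l ds q d r o).trans h).mono ?_
    rw [exec, length_pass, List.length_cons, Nat.succ_mul ds.length]
    omega

theorem reaches_read {B : ℕ} (hB : ∀ q a, (T.next q a).2.length ≤ B) (l : List α) (q : Q)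
    (r : List X) (o : List β) :
    T.machine.Reaches (l.length * (B * (2 * r.length + 3) + 2))
      (config (some (.read q)) { input := l, ruler := r, out := o })
      (config (some (.read (transduce T.read (q, r) l).1.1))
        { ruler := (transduce T.read (q, r) l).1.2,
          out := (transduce T.read (q, r) l).2.reverse ++ o }) := by
  induction l generalizing q r o with
  | nil => exact .refl _ _
  | cons a l ih =>
    have hfetch : T.machine.next (.read q)
        (Store.stack { input := a :: l, ruler := r, out := o }) =
          config (some (.fetch (T.next q a).1))
            { input := l, cmd := (T.next q a).2, ruler := r, out := o } := by
      refine next_eq rfl fun s => ?_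
      cases s
      case cmd => exact List.append_nil _
      all_goals rfl
    have hexec := Reaches.of_next_eq hfetch
      (reaches_execAll l (T.next q a).2 (T.next q a).1 r o)
    have h := ih (T.next q a).1 (T.read (q, r) a).1.2 ((T.read (q, r) a).2.reverse ++ o)
    rw [← List.append_assoc, ← List.reverse_append] at h
    refine (hexec.trans h).mono ?_
    have := Nat.mul_le_mul_right (2 * r.length + 3) (hB q a)
    simp only [read, length_transduce_exec, List.length_cons, Nat.succ_mul l.length]
    omega

theorem reaches_emit (r : List X) (o o' : List β) : T.machine.Reaches (o.length + 1)
    (config (some .emit) { ruler := r, out := o, output := o' })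
    (config (some .clear) { ruler := r, output := o.reverse ++ o' }) := by
  induction o generalizing o' with
  | nil => exact .of_next_eq (next_eq rfl fun s => by cases s <;> rfl) (.refl _ _)
  | cons b o ih =>
    have h := ih (b :: o')
    rw [List.append_cons, ← List.reverse_cons] at h
    exact .of_next_eq (next_eq rfl fun s => by cases s <;> rfl) h

theorem reaches_clear (r : List X) (o : List β) : T.machine.Reaches (r.length + 1)
    (config (some .clear) { ruler := r, output := o }) (config none { output := o }) := by
  induction r with
  | nil => exact .of_next_eq (next_eq rfl fun s => by cases s <;> rfl) (.refl _ _)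
  | cons x r ih => exact .of_next_eq (next_eq rfl fun s => by cases s <;> rfl) ih

variable (T) in
/-- A bound on the number of steps until the whole output has been written in reverse order, as a
polynomial in the input length, if there are at most `B` commands per symbol. -/
noncomputable def readTime (B : ℕ) : Polynomial ℕ :=
  (.X + 1) + (.X + 1) + (.C T.initial.length * (2 * .X + 3) + 1) +
    .X * (.C B * (2 * .X + 3) + 2) + 1

theorem exists_reaches_emit {B : ℕ} (hB : ∀ q a, (T.next q a).2.length ≤ B) (l : List α) :
    ∃ r : List X, r.length = l.length ∧ T.machine.Reaches ((T.readTime B).eval l.length)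
      (config (some .measure) { input := l })
      (config (some .emit) { ruler := r, out := (T.output l).reverse }) := by
  have hmeasure := reaches_measure (T := T) l [] []
  have hrestore := reaches_restore (T := T) [] l.reverse T.initial (List.replicate l.length T.blank)
  have hinitial := reaches_execAll (T := T) l T.initial T.start (List.replicate l.length T.blank) []
  have hread := reaches_read hB l T.start (T.setup l.length).1 (T.setup l.length).2.reverse
  set s := transduce T.read (T.start, (T.setup l.length).1) l with hs
  have hfinal : T.machine.next (.read s.1.1) (Store.stack
        { ruler := s.1.2, out := s.2.reverse ++ (T.setup l.length).2.reverse }) =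
      config (some .emit) { ruler := s.1.2, out := (T.output l).reverse } := by
    refine next_eq rfl fun i => ?_
    cases i
    case out =>
      simp only [output, Store.stack, ← hs, List.reverse_append]
      rfl
    all_goals rfl
  have hsetup : (T.setup l.length).1.length = l.length := by
    rw [setup, length_transduce_exec, List.length_replicate]
  simp only [List.append_nil] at hmeasure hrestore hinitial
  rw [List.reverse_reverse, List.length_reverse] at hrestore
  rw [List.length_replicate] at hinitial
  rw [hsetup] at hread
  refine ⟨s.1.2, (T.length_transduce_read _ l).trans hsetup, Reaches.mono
    (hmeasure.trans <| hrestore.trans <| hinitial.trans <| hread.trans <|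
      .of_next_eq hfinal (.refl 0 _)) ?_⟩
  simp only [readTime, Polynomial.eval_add, Polynomial.eval_mul, Polynomial.eval_X,
    Polynomial.eval_one, Polynomial.eval_C, Polynomial.eval_ofNat]
  omega

instance finite_label [Finite Q] [Finite D] [Finite C] : Finite (Label Q D C) := by
  have := Fintype.ofFinite Q
  have := Fintype.ofFinite D
  have := Fintype.ofFinite C
  infer_instance

theorem exists_reaches_output [Finite α] [Finite β] [Finite Q] [Finite D] [Finite C] [Finite X]
    (T : SweepTransducer α β Q D C X) :
    ∃ p : Polynomial ℕ, ∀ l : List α, T.machine.Reaches (p.eval l.length)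
      (config (some .measure) { input := l }) (config none { output := T.output l }) := by
  have (s : StackName) : Finite (s.Symbol α β D X) := by cases s <;> assumption
  obtain ⟨B, hB⟩ := Finite.exists_le fun s : Q × α => (T.next s.1 s.2).2.length
  obtain ⟨W, hW⟩ := T.machine.exists_length_stack_le
  refine ⟨T.readTime B + (.C W * T.readTime B + 1) + (.X + 1), fun l => ?_⟩
  obtain ⟨r, hr, hemit⟩ := exists_reaches_emit (fun q a => hB (q, a)) l
  have hlength : (T.output l).length ≤ W * (T.readTime B).eval l.length := by
    simpa [Store.stack] using hW hemit .out
  have hreverse := reaches_emit (T := T) r (T.output l).reverse []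
  rw [List.reverse_reverse, List.append_nil, List.length_reverse] at hreverse
  refine ((hemit.trans hreverse).trans (reaches_clear r (T.output l))).mono ?_
  simp only [Polynomial.eval_add, Polynomial.eval_mul, Polynomial.eval_X, Polynomial.eval_one,
    Polynomial.eval_C]
  omega

end Machine

theorem nonempty_tm2ComputableInPolyTime [Finite α] [Finite β] [Finite Q] [Finite D]
    [Finite C] [Finite X] (T : SweepTransducer α β Q D C X) {A B : Type} {ea : A → List α}
    {eb : B → List β} {f : A → B} (h : ∀ x, eb (f x) = T.output (ea x)) :
    Nonempty (Turing.TM2ComputableInPolyTime ea eb f) := by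
  have (s : StackName) : Finite (s.Symbol α β D X) := by cases s <;> assumption
  obtain ⟨p, hp⟩ := T.exists_reaches_output
  refine T.machine.nonempty_tm2ComputableInPolyTime (input := .input) (output := .output)
    .measure p fun x => ?_
  convert hp (ea x) using 2 <;> funext s <;> cases s <;> first | rfl | exact h x

end SweepTransducer

/-! ### Polynomials in cells of variables -/

section Monomials

/-- The kinds of variables of the sentence for rank at most `k`. For every cell `i` there are
`u t` and `v t`, the entries of the two factors in the row `i` and in the column `i`, and `ratio`
and `acc`, the rational number and the partial sum at the position `i` of the computation. -/
inductive Slot (k : ℕ) : Type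
  | u (t : Fin k)
  | v (t : Fin k)
  | ratio
  | acc
  deriving DecidableEq, Fintype

/-- The kind of variable with the given number. -/
noncomputable def slotAt (k : ℕ) (b : Fin (Fintype.card (Slot k))) : Slot k :=
  (Fintype.equivFin (Slot k)).symm b

/-- The number of variables for `L` cells. -/
abbrev numVars (k L : ℕ) : ℕ := L * Fintype.card (Slot k)

/-- The point whose coordinates are the values `y i s` of the variables, cell by cell. -/
noncomputable def point {k : ℕ} (L : ℕ) (y : ℕ → Slot k → ℝ) : Fin (numVars k L) → ℝ :=
  fun v => y v.divNat (slotAt k v.modNat)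

theorem point_surjective (k L : ℕ) : (point (k := k) L).Surjective := by
  intro x
  refine ⟨fun i s => if h : i < L then x (finProdFinEquiv (⟨i, h⟩, Fintype.equivFin _ s)) else 0,
    funext fun v => ?_⟩
  rw [point, dif_pos (v.divNat).isLt, slotAt, Equiv.apply_symm_apply]
  exact congrArg x (finProdFinEquiv.apply_symm_apply v)

/-- A monomial with at most one variable of each kind, located at a place in `P`: a cell, or a
pointer to a cell. -/
abbrev SlotMonomial (k : ℕ) (P : Type) : Type := Slot k → Option P

namespace SlotMonomial

variable {k : ℕ} {P P' : Type}

/-- The monomial that takes its variables from the cells to which its pointers point. -/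
def map (f : P → P') (c : SlotMonomial k P) : SlotMonomial k P' := fun s => (c s).map f

/-- The empty monomial. -/
def one : SlotMonomial k P := fun _ => none

/-- The rational number at the position `p`. -/
def ratio (p : P) : SlotMonomial k P
  | .ratio => some p
  | _ => none

/-- The partial sum at the position `p`. -/
def acc (p : P) : SlotMonomial k P
  | .acc => some p
  | _ => none

/-- The summand for `t` of the entry `(i, j)` of the matrix product, times the rational number at
the position `p`. -/
def product (i j p : P) (t : Fin k) : SlotMonomial k P
  | .u t' => if t' = t then some i else none
  | .v t' => if t' = t then some j else none
  | .ratio => some p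
  | .acc => none

@[simp]
theorem map_one (f : P → P') : (one : SlotMonomial k P).map f = one := rfl

@[simp]
theorem map_ratio (f : P → P') (p : P) : (ratio p : SlotMonomial k P).map f = ratio (f p) := by
  funext s
  cases s <;> rfl

@[simp]
theorem map_acc (f : P → P') (p : P) : (acc p : SlotMonomial k P).map f = acc (f p) := by
  funext s
  cases s <;> rfl

@[simp]
theorem map_product (f : P → P') (i j p : P) (t : Fin k) :
    (product i j p t).map f = product (f i) (f j) (f p) t := by
  funext s
  cases s <;> simp [map, product, apply_ite]

/-- The value of a monomial. -/
def value (c : SlotMonomial k ℕ) (y : ℕ → Slot k → ℝ) : ℝ := ∏ s, (c s).elim 1 fun i => y i s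

@[simp]
theorem value_one (y : ℕ → Slot k → ℝ) : one.value y = 1 := by
  simp [value, one]

@[simp]
theorem value_ratio (p : ℕ) (y : ℕ → Slot k → ℝ) : (ratio p).value y = y p .ratio := by
  refine Fintype.prod_eq_single Slot.ratio fun s hs => ?_
  cases s <;> first | rfl | exact absurd rfl hs

@[simp]
theorem value_acc (p : ℕ) (y : ℕ → Slot k → ℝ) : (acc p).value y = y p .acc := by
  refine Fintype.prod_eq_single Slot.acc fun s hs => ?_
  cases s <;> first | rfl | exact absurd rfl hs

@[simp]
theorem value_product (i j p : ℕ) (t : Fin k) (y : ℕ → Slot k → ℝ) :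
    (product i j p t).value y = y i (.u t) * y j (.v t) * y p .ratio := by
  rw [value, ← Finset.prod_subset (Finset.subset_univ {.u t, .v t, .ratio}) fun s _ hs => ?_]
  · simp [product, mul_assoc]
  · cases s <;> simp_all [product]

/-- All variables of the monomial belong to the first `L` cells. -/
def Below (L : ℕ) (c : SlotMonomial k ℕ) : Prop := ∀ s, ∀ i ∈ c s, i < L

theorem below_one (L : ℕ) : (one : SlotMonomial k ℕ).Below L := by
  simp [Below, one]

theorem below_ratio {L p : ℕ} (hp : p < L) : (ratio p : SlotMonomial k ℕ).Below L := by
  intro s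
  cases s <;> simp [ratio, hp]

theorem below_acc {L p : ℕ} (hp : p < L) : (acc p : SlotMonomial k ℕ).Below L := by
  intro s
  cases s <;> simp [acc, hp]

theorem below_product {L i j p : ℕ} (hi : i < L) (hj : j < L) (hp : p < L) (t : Fin k) :
    (product i j p t).Below L := by
  intro s
  cases s <;> simp [product, hi, hj, hp]

/-- The exponent vector of a monomial for `L` cells. -/
noncomputable def expVec (L : ℕ) (c : SlotMonomial k ℕ) : Fin (numVars k L) → ℕ :=
  fun v => (c (slotAt k v.modNat)).elim 0 fun i => (decide ((v.divNat : ℕ) = i)).toNat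

theorem prod_point_pow_expVec {L : ℕ} {c : SlotMonomial k ℕ} (hc : c.Below L)
    (y : ℕ → Slot k → ℝ) : ∏ v, point L y v ^ c.expVec L v = c.value y := by
  have hslot (s : Slot k) :
      ∏ a : Fin L, y a s ^ ((c s).elim 0 fun i => (decide ((a : ℕ) = i)).toNat) =
        (c s).elim 1 fun i => y i s := by
    cases hs : c s with
    | none => simp
    | some i =>
      refine (Fintype.prod_eq_single ⟨i, hc s i hs⟩ fun a ha => ?_).trans (by simp)
      have hai : (a : ℕ) ≠ i := fun h => ha (Fin.ext h)
      simp [hai]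
  calc ∏ v, point L y v ^ c.expVec L v
      = ∏ b, ∏ a : Fin L, y a (slotAt k b) ^
          ((c (slotAt k b)).elim 0 fun i => (decide ((a : ℕ) = i)).toNat) := by
        rw [Finset.prod_comm, ← Fintype.prod_prod_type', ← finProdFinEquiv.symm.prod_comp]
        rfl
    _ = c.value y := by
        simp only [hslot]
        exact Equiv.prod_comp (Fintype.equivFin (Slot k)).symm
          fun s => (c s).elim 1 fun i => y i s

end SlotMonomial

/-- A list of integer multiples of monomials with at most one variable of each kind. -/
abbrev SlotPoly (k : ℕ) (P : Type) : Type := List (ℤ × SlotMonomial k P)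

namespace SlotPoly

variable {k : ℕ} {P P' : Type}

/-- The polynomial that takes its variables from the cells to which its pointers point. -/
def mapPlaces (f : P → P') (p : SlotPoly k P) : SlotPoly k P' := p.map fun c => (c.1, c.2.map f)

/-- The value of a polynomial. -/
def value (p : SlotPoly k ℕ) (y : ℕ → Slot k → ℝ) : ℝ :=
  (p.map fun c => (c.1 : ℝ) * c.2.value y).sum

/-- The polynomial for `L` cells in sparse form. -/
noncomputable def toSparse (L : ℕ) (p : SlotPoly k ℕ) : SparsePoly (numVars k L) :=
  p.map fun c => (c.1, c.2.expVec L)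

/-- All variables of the polynomial belong to the first `L` cells. -/
def Below (L : ℕ) (p : SlotPoly k ℕ) : Prop := ∀ c ∈ p, c.2.Below L

theorem eval_toSparse_point {L : ℕ} {p : SlotPoly k ℕ} (hp : p.Below L) (y : ℕ → Slot k → ℝ) :
    (p.toSparse L).eval (point L y) = p.value y := by
  rw [SparsePoly.eval, toSparse, List.map_map, value]
  exact congrArg List.sum (List.map_congr_left fun c hc =>
    congrArg _ (SlotMonomial.prod_point_pow_expVec (hp c hc) y))

@[simp]
theorem value_nil (y : ℕ → Slot k → ℝ) : value [] y = 0 := rfl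

@[simp]
theorem value_cons (c : ℤ × SlotMonomial k ℕ) (p : SlotPoly k ℕ) (y : ℕ → Slot k → ℝ) :
    value (c :: p) y = c.1 * c.2.value y + p.value y := by
  simp [value]

@[simp]
theorem value_append (p p' : SlotPoly k ℕ) (y : ℕ → Slot k → ℝ) :
    value (p ++ p') y = p.value y + p'.value y := by
  simp [value]

/-- `r.num - r.den * ratio` at the position `p`. -/
def ratioEq (r : ℚ) (p : P) : SlotPoly k P := [(r.num, .one), (-(r.den : ℤ), .ratio p)]

theorem value_ratioEq_eq_zero_iff (r : ℚ) (p : ℕ) (y : ℕ → Slot k → ℝ) :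
    (ratioEq r p).value y = 0 ↔ y p .ratio = r := by
  have hden : (r.den : ℝ) ≠ 0 := Nat.cast_ne_zero.2 r.den_ne_zero
  have hvalue : (ratioEq r p).value y = r.num - y p .ratio * r.den := by
    simp [ratioEq, mul_comm, sub_eq_add_neg]
  rw [hvalue, Rat.cast_def, eq_div_iff hden, sub_eq_zero, eq_comm]

/-- The partial sum after the position `p`, where the entry `(i, j)` of the matrix product times the
rational number at the position `p` is added. -/
def accNext (i j p : P) : SlotPoly k P :=
  (1, .acc p) :: (List.finRange k).map fun t => (1, .product i j p t)

theorem mapPlaces_accNext (f : P → P') (i j p : P) :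
    mapPlaces f (accNext (k := k) i j p) = accNext (f i) (f j) (f p) := by
  simp [mapPlaces, accNext]

theorem value_accNext (i j p : ℕ) (y : ℕ → Slot k → ℝ) : (accNext i j p).value y =
    y p .acc + y p .ratio * ∑ t, y i (.u t) * y j (.v t) := by
  rw [accNext, value_cons, value, List.map_map, ← List.ofFn_eq_map, List.sum_ofFn, Finset.mul_sum]
  simp [mul_comm]

end SlotPoly

end Monomials

/-! ### Accumulation of inner products -/

section Semantics

/-- The conjunction of the equations `p = 0`, closed by the trivial equation `0 = 0`. -/
def allZero {N : ℕ} (ps : List (SparsePoly N)) : QFFormula N :=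
  ps.foldr (fun p φ => .conj (.atom .eqZero p) φ) (.atom .eqZero [])

theorem sat_allZero {N : ℕ} (ps : List (SparsePoly N)) (x : Fin N → ℝ) :
    (allZero ps).Sat x ↔ ∀ p ∈ ps, p.eval x = 0 := by
  induction ps with
  | nil => simp [allZero, QFFormula.Sat, AtomKind.Holds, SparsePoly.eval]
  | cons p ps ih => simpa [allZero, QFFormula.Sat, AtomKind.Holds] using fun _ => ih

/-- The instructions for the evaluation of affine constraints with an accumulator: `add i j a` adds
`a` times the entry `(i, j)` of a matrix, and `check b` compares the accumulator with `b` and clears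
it. -/
inductive Instruction : Type
  | add (i j : ℕ) (a : ℚ)
  | check (b : ℚ)

namespace Instruction

/-- All checks are passed for the matrix `g` if the accumulator contains `s` initially. -/
def Accepts (g : ℕ → ℕ → ℝ) : ℝ → List Instruction → Prop
  | _, [] => True
  | s, add i j a :: l => Accepts g (s + a * g i j) l
  | s, check b :: l => s = b ∧ Accepts g 0 l

/-- `r` is the number in the instruction, which takes the accumulator from `s` to `s'` for the
matrix `g` and does not fail. -/
def Performs (g : ℕ → ℕ → ℝ) (r s s' : ℝ) : Instruction → Prop
  | add i j a => r = a ∧ s' = s + r * g i j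
  | check b => r = b ∧ s = r ∧ s' = 0

/-- `R` and `S` are the numbers in the instructions and the values of the accumulator. -/
def IsTrace (g : ℕ → ℕ → ℝ) (R S : ℕ → ℝ) : List Instruction → Prop
  | [] => True
  | x :: l => x.Performs g (R 0) (S 0) (S 1) ∧ IsTrace g (R ∘ Nat.succ) (S ∘ Nat.succ) l

theorem exists_isTrace_cons {g : ℕ → ℕ → ℝ} {s : ℝ} {x : Instruction} {l : List Instruction} :
    (∃ R S : ℕ → ℝ, S 0 = s ∧ IsTrace g R S (x :: l)) ↔ ∃ r s', x.Performs g r s s' ∧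
      ∃ R S : ℕ → ℝ, S 0 = s' ∧ IsTrace g R S l := by
  constructor
  · rintro ⟨R, S, rfl, hx, hl⟩
    exact ⟨R 0, S 1, hx, R ∘ Nat.succ, S ∘ Nat.succ, rfl, hl⟩
  · rintro ⟨r, s', hx, R, S, rfl, hl⟩
    exact ⟨fun | 0 => r | p + 1 => R p, fun | 0 => s | p + 1 => S p, rfl, hx, hl⟩

theorem exists_isTrace_iff {g : ℕ → ℕ → ℝ} {s : ℝ} {l : List Instruction} :
    (∃ R S : ℕ → ℝ, S 0 = s ∧ IsTrace g R S l) ↔ Accepts g s l := by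
  induction l generalizing s with
  | nil => exact ⟨fun _ => trivial, fun _ => ⟨0, fun _ => s, rfl, trivial⟩⟩
  | cons x l ih =>
    simp only [exists_isTrace_cons, ih]
    cases x <;> simp [Performs, Accepts, and_assoc]

theorem accepts_flatMap_append {ι : Type*} {g : ℕ → ℕ → ℝ} {F : ι → List Instruction} {v : ι → ℝ}
    (h : ∀ x s l, Accepts g s (F x ++ l) ↔ Accepts g (s + v x) l) (c : List ι) (s : ℝ)
    (l : List Instruction) :
    Accepts g s (c.flatMap F ++ l) ↔ Accepts g (s + (c.map v).sum) l := by
  induction c generalizing s with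
  | nil => simp
  | cons x c ih => simp [h, ih, add_assoc]

open SlotMonomial

variable {k : ℕ}

/-- The polynomials that vanish if and only if the instruction at the position `p` is performed. -/
def polys : Instruction → ℕ → List (SlotPoly k ℕ)
  | add i j a, p => [SlotPoly.ratioEq a p, SlotPoly.accNext i j p ++ [(-1, .acc (p + 1))]]
  | check b, p => [SlotPoly.ratioEq b p, [(1, .acc p), (-1, .ratio p)], [(1, .acc (p + 1))]]

/-- The polynomials for a list of instructions that starts at the position `p`. -/
def polysFrom : ℕ → List Instruction → List (SlotPoly k ℕ)
  | _, [] => []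
  | p, x :: l => x.polys p ++ polysFrom (p + 1) l

theorem polysFrom_append (p : ℕ) (l l' : List Instruction) :
    (polysFrom p (l ++ l') : List (SlotPoly k ℕ)) =
      polysFrom p l ++ polysFrom (p + l.length) l' := by
  induction l generalizing p with
  | nil => rfl
  | cons x l ih => simp [polysFrom, ih, Nat.add_comm, Nat.add_left_comm]

/-- The matrix product of the factors in the variables `u t` and `v t`. -/
def slotProduct (y : ℕ → Slot k → ℝ) (i j : ℕ) : ℝ := ∑ t, y i (.u t) * y j (.v t)

theorem value_polys_eq_zero_iff (y : ℕ → Slot k → ℝ) (x : Instruction) (p : ℕ) :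
    (∀ e ∈ x.polys p, e.value y = 0) ↔
      x.Performs (slotProduct y) (y p .ratio) (y p .acc) (y (p + 1) .acc) := by
  cases x with
  | add i j a =>
    simp [polys, Performs, SlotPoly.value_ratioEq_eq_zero_iff, SlotPoly.value_accNext, slotProduct,
      add_neg_eq_zero, eq_comm (a := y (p + 1) .acc)]
  | check b =>
    simp [polys, Performs, SlotPoly.value_ratioEq_eq_zero_iff, add_neg_eq_zero]

theorem value_polysFrom_eq_zero_iff (y : ℕ → Slot k → ℝ) (l : List Instruction) (p : ℕ) :
    (∀ e ∈ polysFrom p l, e.value y = 0) ↔ IsTrace (slotProduct y)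
      (fun n => y (p + n) .ratio) (fun n => y (p + n) .acc) l := by
  induction l generalizing p with
  | nil => simp [polysFrom, IsTrace]
  | cons x l ih =>
    simp only [polysFrom, List.forall_mem_append, value_polys_eq_zero_iff, ih, IsTrace,
      Function.comp_def, Nat.succ_eq_add_one, Nat.add_zero, Nat.add_assoc, Nat.add_comm 1]

/-- The indices in the instruction are less than `L`. -/
def Below (L : ℕ) : Instruction → Prop
  | add i j _ => i < L ∧ j < L
  | check _ => True

theorem below_polys {L p : ℕ} {x : Instruction} (hx : x.Below L) (hp : p + 1 < L) :
    ∀ e ∈ x.polys (k := k) p, SlotPoly.Below L e := by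
  have hp' : p < L := Nat.lt_of_succ_lt hp
  have hratioEq (r : ℚ) : SlotPoly.Below L (SlotPoly.ratioEq (k := k) r p) :=
    List.forall_mem_cons.2 ⟨below_one L, List.forall_mem_singleton.2 (below_ratio hp')⟩
  have hacc (z : ℤ) : SlotPoly.Below L [(z, acc (k := k) (p + 1))] :=
    List.forall_mem_singleton.2 (below_acc hp)
  cases x with
  | add i j a =>
    have haccNext : SlotPoly.Below L (SlotPoly.accNext (k := k) i j p) :=
      List.forall_mem_cons.2 ⟨below_acc hp',
        List.forall_mem_map.2 fun t _ => below_product hx.1 hx.2 hp' t⟩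
    exact List.forall_mem_cons.2 ⟨hratioEq a, List.forall_mem_singleton.2 <|
      List.forall_mem_append.2 ⟨haccNext, hacc _⟩⟩
  | check b =>
    have hcompare : SlotPoly.Below L [(1, acc (k := k) p), (-1, .ratio p)] :=
      List.forall_mem_cons.2 ⟨below_acc hp', List.forall_mem_singleton.2 (below_ratio hp')⟩
    exact List.forall_mem_cons.2 ⟨hratioEq b, List.forall_mem_cons.2
      ⟨hcompare, List.forall_mem_singleton.2 (hacc _)⟩⟩

theorem below_polysFrom {L p : ℕ} {l : List Instruction} (hl : ∀ x ∈ l, x.Below L)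
    (hp : p + l.length < L) : ∀ e ∈ polysFrom (k := k) p l, SlotPoly.Below L e := by
  induction l generalizing p with
  | nil => simp [polysFrom]
  | cons x l ih =>
    rw [List.length_cons] at hp
    rw [List.forall_mem_cons] at hl
    exact List.forall_mem_append.2 ⟨below_polys hl.1 (by omega), ih hl.2 (by omega)⟩

/-- The formula for `L` cells which says that all checks are passed for the product of the factors
in the variables `u t` and `v t`. -/
noncomputable def formula (k L : ℕ) (l : List Instruction) : QFFormula (numVars k L) :=
  allZero (([(1, .acc 0)] :: polysFrom 0 l).map (SlotPoly.toSparse L))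

theorem sat_formula_point {L : ℕ} {l : List Instruction} (hl : ∀ x ∈ l, x.Below L)
    (hlength : l.length < L) (y : ℕ → Slot k → ℝ) : (formula k L l).Sat (point L y) ↔
      y 0 .acc = 0 ∧ IsTrace (slotProduct y) (y · .ratio) (y · .acc) l := by
  have hbelow : ∀ e ∈ [(1, .acc 0)] :: polysFrom (k := k) 0 l, SlotPoly.Below L e :=
    List.forall_mem_cons.2 ⟨List.forall_mem_singleton.2 (below_acc (Nat.zero_lt_of_lt hlength)),
      below_polysFrom hl (by rwa [Nat.zero_add])⟩
  have heval : (∀ e ∈ [(1, .acc 0)] :: polysFrom 0 l,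
        (SlotPoly.toSparse L e).eval (point L y) = 0) ↔
      ∀ e ∈ [(1, .acc 0)] :: polysFrom 0 l, SlotPoly.value e y = 0 :=
    forall₂_congr fun e he => by rw [SlotPoly.eval_toSparse_point (hbelow e he)]
  rw [formula, sat_allZero, List.forall_mem_map, heval, List.forall_mem_cons,
    value_polysFrom_eq_zero_iff]
  simp

theorem exists_sat_formula_iff {L : ℕ} {l : List Instruction} (hl : ∀ x ∈ l, x.Below L)
    (hlength : l.length < L) : (∃ x, (formula k L l).Sat x) ↔
      ∃ U V : ℕ → Fin k → ℝ, Accepts (fun i j => ∑ t, U i t * V j t) 0 l := by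
  simp only [(point_surjective k L).exists, sat_formula_point hl hlength, ← exists_isTrace_iff]
  constructor
  · rintro ⟨y, hzero, htrace⟩
    exact ⟨fun i t => y i (.u t), fun j t => y j (.v t), _, _, hzero, htrace⟩
  · rintro ⟨U, V, R, S, hzero, htrace⟩
    exact ⟨fun i => fun | .u t => U i t | .v t => V i t | .ratio => R i | .acc => S i,
      hzero, htrace⟩

end Instruction

end Semantics

/-! ### The transducer of the reduction -/

section Transducer

variable {k : ℕ}

/-- The pointers to cells of the ruler: to the current row and column of the matrix, where rows are
counted from one, and to the current position of the computation. -/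
inductive Pointer : Type
  | row
  | col
  | pos
  deriving DecidableEq

instance : Fintype Pointer :=
  ⟨{.row, .col, .pos}, fun a => by cases a <;> simp⟩

/-- The part of an instance that is being read. In the state `fresh rhs` a number is awaited, which
is a right-hand side or a matrix entry. -/
inductive Mode : Type
  | outside
  | fresh (rhs : Bool)
  | numerator (rhs : Bool)
  | denominator (rhs : Bool)
  deriving Fintype

/-- The commands of the transducer: write a symbol, write the exponent vector of a monomial, write
the quantifiers, increase or reset a pointer. -/
inductive Command (k : ℕ) : Type
  | write (t : Token)
  | vector (c : SlotMonomial k Pointer)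
  | quantify
  | inc (a : Pointer)
  | reset (a : Pointer)
  deriving Fintype

namespace Command

/-- The commands that write a sum of monomials. -/
def terms (p : SlotPoly k Pointer) : List (Command k) :=
  p.flatMap fun c => (Token.monomial :: encInt c.1).map write ++ [vector c.2]

/-- The commands that write the beginning of a formula `p = 0 ∧ φ` up to the polynomial `p`. -/
def openClause : List (Command k) := [write .conj, write .eqZero]

/-- The commands that write the beginning of a formula `p = 0 ∧ φ` up to the formula `φ`. -/
def clause (p : SlotPoly k Pointer) : List (Command k) :=
  openClause ++ terms p ++ [write .endPoly]

/-- The commands that complete the polynomials of an instruction after its number. -/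
def finish : Bool → List (Command k)
  | false => openClause ++ terms (.accNext .row .col .pos) ++ [inc .pos] ++
      terms [(-1, .acc .pos)] ++ [write .endPoly, inc .col]
  | true => clause [(1, .acc .pos), (-1, .ratio .pos)] ++ [inc .pos] ++ clause [(1, .acc .pos)]

end Command

namespace Mode

/-- The mode after a number. -/
def afterNumber : Bool → Mode
  | false => fresh false
  | true => outside

/-- The next mode and the commands to be executed when a symbol of a number is read. The number
`±a / b` is written as the polynomial `±a - b * ratio`. -/
def nextInNumber : Mode → Token → Mode × List (Command k)
  | numerator rhs, .slash => (denominator rhs,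
      [.write .endNum, .vector .one, .write .monomial, .write .minus])
  | numerator rhs, t => (numerator rhs, [.write t])
  | denominator rhs, .endNum => (afterNumber rhs,
      [.write .endNum, .vector (.ratio .pos), .write .endPoly] ++ Command.finish rhs)
  | denominator rhs, t => (denominator rhs, [.write t])
  | s, _ => (s, [])

/-- The next mode and the commands to be executed when a symbol is read. -/
def next : Mode → Token → Mode × List (Command k)
  | _, .matrix => (fresh false, [])
  | _, .row => (fresh false, [.inc .row, .reset .col])
  | _, .rhs => (fresh true, [.reset .row, .reset .col])
  | fresh rhs, t => ((nextInNumber (k := k) (numerator rhs) t).1,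
      Command.openClause ++ .write .monomial :: (nextInNumber (numerator rhs) t).2)
  | s, t => nextInNumber s t

end Mode

/-- The transducer that reads an affine rank minimization instance and writes the sentence for rank
at most `k`. In a cell, `x a` tells whether the pointer `a` points to the cell. -/
noncomputable def armTransducer (k : ℕ) :
    SweepTransducer Token Token Mode (Command k) Bool (Pointer → Bool) where
  start := .outside
  initial := [.quantify, .reset .row, .reset .col, .reset .pos] ++ Command.clause [(1, .acc .pos)]
  next := Mode.next
  word
    | .write t => [t]
    | _ => []
  carry
    | .reset _ => true
    | _ => false
  sweep
    | .write _, c, x => (c, x, [])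
    | .vector p, c, x => (c, x, encFin encNat fun b => (p (slotAt k b)).elim 0 fun a => (x a).toNat)
    | .quantify, c, x => (c, x, List.replicate (Fintype.card (Slot k)) .ex)
    | .inc a, c, x => (x a, Function.update x a c, [])
    | .reset a, c, x => (false, Function.update x a c, [])
  blank := fun _ => false
  final := [.eqZero, .endPoly]

end Transducer

section Ruler

variable {k : ℕ}

/-- The content of the cell `i` if the pointers have the positions `ptr`. -/
def cell (ptr : Pointer → ℕ) (i : ℕ) : Pointer → Bool := fun a => decide (i = ptr a)

theorem update_cell (ptr : Pointer → ℕ) (a : Pointer) (n i : ℕ) :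
    Function.update (cell ptr i) a (decide (i = n)) = cell (Function.update ptr a n) i := by
  funext b
  obtain rfl | hb := eq_or_ne b a
  · simp [cell]
  · simp [cell, hb]

/-- The ruler with `L` cells in which the pointers have the positions `ptr`. -/
def ruler (L : ℕ) (ptr : Pointer → ℕ) : List (Pointer → Bool) := (List.range' 0 L).map (cell ptr)

@[simp]
theorem length_ruler (L : ℕ) (ptr : Pointer → ℕ) : (ruler L ptr).length = L := by
  simp [ruler]

theorem replicate_false (L : ℕ) : List.replicate L (fun _ => false) = ruler L fun _ => L := by
  refine (List.eq_replicate_iff.2 ⟨length_ruler _ _, List.forall_mem_map.2 fun i hi => ?_⟩).symm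
  have hiL : i < L := by simpa using hi
  exact funext fun _ => decide_eq_false hiL.ne

theorem SweepTransducer.pass_map_range' {α β Q D C X : Type} (T : SweepTransducer α β Q D C X)
    {d : D} {c : ℕ → C} {x x' : ℕ → X} {w : ℕ → List β}
    (h : ∀ i, T.sweep d (c i) (x i) = (c (i + 1), x' i, w i)) (s n : ℕ) :
    T.pass d (c s) ((List.range' s n).map x) =
      ((List.range' s n).map x', (List.range' s n).flatMap w) := by
  induction n generalizing s with
  | zero => rfl
  | succ n ih => simp [List.range'_succ, pass, h, ih]

variable {ptr : Pointer → ℕ}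

theorem exec_ruler {d : Command k} {ptr' : Pointer → ℕ} {c : ℕ → Bool} {w : ℕ → List Token}
    (h : ∀ i, (armTransducer k).sweep d (c i) (cell ptr i) = (c (i + 1), cell ptr' i, w i))
    (hcarry : (armTransducer k).carry d = c 0) (L : ℕ) :
    (armTransducer k).exec (ruler L ptr) d =
      (ruler L ptr', (armTransducer k).word d ++ (List.range' 0 L).flatMap w) := by
  rw [SweepTransducer.exec, hcarry, ruler, SweepTransducer.pass_map_range' _ h, ruler]

variable (L : ℕ) (ptr)

@[simp]
theorem exec_write (t : Token) :
    (armTransducer k).exec (ruler L ptr) (.write t) = (ruler L ptr, [t]) :=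
  (exec_ruler (c := fun _ => false) (fun _ => rfl) rfl L).trans
    (by simp [armTransducer, List.flatMap])

@[simp]
theorem exec_inc (a : Pointer) : (armTransducer k).exec (ruler L ptr) (.inc a) =
    (ruler L (Function.update ptr a (ptr a + 1)), []) := by
  have hsweep (i : ℕ) : (armTransducer k).sweep (.inc a) (decide (i = ptr a + 1)) (cell ptr i) =
      (decide (i + 1 = ptr a + 1), cell (Function.update ptr a (ptr a + 1)) i, []) := by
    rw [← update_cell]
    simp [armTransducer, cell]
  exact (exec_ruler hsweep (by simp [armTransducer]) L).trans (by simp [armTransducer])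

@[simp]
theorem exec_reset (a : Pointer) : (armTransducer k).exec (ruler L ptr) (.reset a) =
    (ruler L (Function.update ptr a 0), []) := by
  have hsweep (i : ℕ) : (armTransducer k).sweep (.reset a) (decide (i = 0)) (cell ptr i) =
      (decide (i + 1 = 0), cell (Function.update ptr a 0) i, []) := by
    rw [← update_cell]
    simp [armTransducer]
  exact (exec_ruler hsweep (by simp [armTransducer]) L).trans (by simp [armTransducer])

@[simp]
theorem exec_quantify : (armTransducer k).exec (ruler L ptr) .quantify =
    (ruler L ptr, List.replicate (numVars k L) .ex) := by
  refine (exec_ruler (c := fun _ => false) (fun _ => rfl) rfl L).trans ?_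
  simp [armTransducer, List.flatMap]

@[simp]
theorem exec_vector (c : SlotMonomial k Pointer) :
    (armTransducer k).exec (ruler L ptr) (.vector c) =
      (ruler L ptr, encFin encNat ((c.map ptr).expVec L)) := by
  refine (exec_ruler (c := fun _ => false) (fun _ => rfl) rfl L).trans ?_
  have hexp (i : Fin L) (b : Fin (Fintype.card (Slot k))) (hib) :
      (c.map ptr).expVec L ⟨i * Fintype.card (Slot k) + b, hib⟩ =
        (c (slotAt k b)).elim 0 fun a => (cell ptr i a).toNat := by
    have hdivNat : Fin.divNat (⟨i * Fintype.card (Slot k) + b, hib⟩ : Fin (numVars k L)) = i := by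
      simp [Fin.ext_iff, Nat.mul_add_div, Nat.mul_comm _ (Fintype.card (Slot k)), b.pos]
    have hmodNat : Fin.modNat (⟨i * Fintype.card (Slot k) + b, hib⟩ : Fin (numVars k L)) = b := by
      simp [Fin.ext_iff, Nat.mod_eq_of_lt]
    rw [SlotMonomial.expVec, hdivNat, hmodNat, SlotMonomial.map, Option.elim_map]
    rfl
  rw [← List.range_eq_range', ← List.map_coe_finRange_eq_range, List.flatMap_map, encFin,
    List.ofFn_mul, List.flatten_eq_flatMap, List.flatMap_assoc, List.ofFn_eq_map, List.flatMap_map]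
  simp only [hexp]
  rfl

end Ruler

section Text

variable {k : ℕ}

/-- The text of a formula `p = 0 ∧ φ` up to the formula `φ`. -/
def clauseText {N : ℕ} (p : SparsePoly N) : List Token := .conj :: .eqZero :: encPoly p

theorem encode_allZero {N : ℕ} (ps : List (SparsePoly N)) :
    (allZero ps).encode = ps.flatMap clauseText ++ [.eqZero, .endPoly] := by
  induction ps with
  | nil => rfl
  | cons p ps ih =>
    rw [List.flatMap_cons, List.append_assoc, ← ih]
    rfl

theorem transduce_append_eq {σ α β : Type*} {f : σ → α → σ × List β} {s s' s'' : σ}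
    {l l' : List α} {w w' : List β} (h : transduce f s l = (s', w))
    (h' : transduce f s' l' = (s'', w')) : transduce f s (l ++ l') = (s'', w ++ w') := by
  rw [transduce_append, h, h']

section Commands

open Command

variable (L : ℕ) (ptr : Pointer → ℕ)

theorem transduce_map_write (ts : List Token) :
    transduce (armTransducer k).exec (ruler L ptr) (ts.map write) = (ruler L ptr, ts) := by
  induction ts with
  | nil => rfl
  | cons t ts ih => simp [transduce, ih]

theorem transduce_terms (P : SlotPoly k Pointer) :
    transduce (armTransducer k).exec (ruler L ptr) (terms P) = (ruler L ptr,
      (SlotPoly.toSparse L (SlotPoly.mapPlaces ptr P)).flatMap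
        fun c => .monomial :: encMonomial c) := by
  induction P with
  | nil => rfl
  | cons c P ih =>
    rw [terms, List.flatMap_cons, ← terms]
    simp only [transduce_append, transduce_map_write, transduce, exec_vector, ih]
    simp [SlotPoly.mapPlaces, SlotPoly.toSparse, encMonomial]

theorem transduce_clause (P : SlotPoly k Pointer) :
    transduce (armTransducer k).exec (ruler L ptr) (clause P) =
      (ruler L ptr, clauseText (SlotPoly.toSparse L (SlotPoly.mapPlaces ptr P))) := by
  simp [clause, openClause, transduce, transduce_append, transduce_terms, clauseText, encPoly]

variable {L} {ptr}

/-- The positions of the pointers at the row `i`, the column `j` and the position `p`. -/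
def pointers (i j p : ℕ) : Pointer → ℕ
  | .row => i
  | .col => j
  | .pos => p

@[simp]
theorem update_pointers_row (i j p i' : ℕ) :
    Function.update (pointers i j p) .row i' = pointers i' j p := by
  funext a
  cases a <;> rfl

@[simp]
theorem update_pointers_col (i j p j' : ℕ) :
    Function.update (pointers i j p) .col j' = pointers i j' p := by
  funext a
  cases a <;> rfl

@[simp]
theorem update_pointers_pos (i j p p' : ℕ) :
    Function.update (pointers i j p) .pos p' = pointers i j p' := by
  funext a
  cases a <;> rfl

end Commands

section Reader

open Mode

variable {L : ℕ} {ptr : Pointer → ℕ} {rhs : Bool}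

theorem transduce_read_singleton {s s' : Mode} {t : Token} {l : List (Command k)}
    {r r' : List (Pointer → Bool)} {w : List Token} (hnext : s.next t = (s', l))
    (hl : transduce (armTransducer k).exec r l = (r', w)) :
    transduce (armTransducer k).read (s, r) [t] = ((s', r'), w) := by
  have hnext' : (armTransducer k).next s t = (s', l) := hnext
  simp [transduce, SweepTransducer.read, hnext', hl]

theorem transduce_read_write {s : Mode} {ts : List Token}
    (hts : ∀ t ∈ ts, s.next (k := k) t = (s, [.write t])) :
    transduce (armTransducer k).read (s, ruler L ptr) ts = ((s, ruler L ptr), ts) := by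
  induction ts with
  | nil => rfl
  | cons t ts ih =>
    rw [List.forall_mem_cons] at hts
    exact transduce_append_eq (transduce_read_singleton hts.1 (transduce_map_write L ptr [t]))
      (ih hts.2)

theorem forall_mem_encSign_append_bitsNat (z : ℤ) (n : ℕ) :
    ∀ t ∈ encSign z ++ bitsNat n, t = .minus ∨ ∃ b, t = .bit b := by
  intro t ht
  obtain ht | ht := List.mem_append.1 ht
  · rw [encSign] at ht
    split_ifs at ht <;> simp_all
  · obtain ⟨b, -, rfl⟩ := List.mem_map.1 ht
    exact .inr ⟨b, rfl⟩

theorem transduce_read_numerator (z : ℤ) :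
    transduce (armTransducer k).read (numerator rhs, ruler L ptr)
        (encSign z ++ bitsNat z.natAbs ++ [.slash]) =
      ((denominator rhs, ruler L ptr),
        encInt z ++ (encFin encNat (SlotMonomial.expVec (k := k) L .one) ++
          [.monomial, .minus])) := by
  have hslash : transduce (armTransducer k).read (numerator rhs, ruler L ptr) [.slash] =
      ((denominator rhs, ruler L ptr), .endNum ::
        (encFin encNat (SlotMonomial.expVec (k := k) L .one) ++ [.monomial, .minus])) :=
    transduce_read_singleton rfl (by simp [transduce])
  rw [transduce_append_eq (transduce_read_write fun t ht => ?_) hslash]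
  · simp [encInt]
  · obtain rfl | ⟨b, rfl⟩ := forall_mem_encSign_append_bitsNat _ _ t ht <;> rfl

theorem transduce_read_denominator (d : ℕ) {r : List (Pointer → Bool)} {w : List Token}
    (hfinish : transduce (armTransducer k).exec (ruler L ptr) (Command.finish rhs) = (r, w)) :
    transduce (armTransducer k).read (denominator rhs, ruler L ptr) (encNat d) =
      ((afterNumber rhs, r), encNat d ++
        (encFin encNat (SlotMonomial.expVec (k := k) L (.ratio (ptr .pos))) ++ .endPoly :: w)) := by
  have hend : transduce (armTransducer k).read (denominator rhs, ruler L ptr) [.endNum] =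
      ((afterNumber rhs, r), .endNum ::
        (encFin encNat (SlotMonomial.expVec (k := k) L (.ratio (ptr .pos))) ++ .endPoly :: w)) :=
    transduce_read_singleton rfl (by simp [transduce, hfinish])
  rw [encNat, transduce_append_eq (transduce_read_write fun t ht => ?_) hend]
  · simp
  · obtain ⟨b, -, rfl⟩ := List.mem_map.1 ht
    rfl

theorem transduce_read_fresh {t : Token} (ht : t ≠ .matrix ∧ t ≠ .row ∧ t ≠ .rhs)
    {ts w : List Token} {s : Mode × List (Pointer → Bool)}
    (h : transduce (armTransducer k).read (numerator rhs, ruler L ptr) (t :: ts) = (s, w)) :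
    transduce (armTransducer k).read (fresh rhs, ruler L ptr) (t :: ts) =
      (s, .conj :: .eqZero :: .monomial :: w) := by
  have hnext : (armTransducer k).next (fresh rhs) t = (((armTransducer k).next (numerator rhs) t).1,
      Command.openClause ++ .write .monomial :: ((armTransducer k).next (numerator rhs) t).2) := by
    cases t <;> first | rfl | simp_all
  obtain ⟨rfl, rfl⟩ := Prod.ext_iff.1 h
  simp [transduce, SweepTransducer.read, hnext, Command.openClause]

theorem transduce_read_encRat (a : ℚ) {r : List (Pointer → Bool)} {w : List Token}
    (hfinish : transduce (armTransducer k).exec (ruler L ptr) (Command.finish rhs) = (r, w)) :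
    transduce (armTransducer k).read (fresh rhs, ruler L ptr) (encRat a) =
      ((afterNumber rhs, r),
        clauseText (SlotPoly.toSparse (k := k) L (SlotPoly.ratioEq a (ptr .pos))) ++ w) := by
  have hnumber := transduce_append_eq (transduce_read_numerator a.num)
    (transduce_read_denominator a.den hfinish)
  have htext : .conj :: .eqZero :: .monomial :: (encInt a.num ++
      (encFin encNat (SlotMonomial.expVec (k := k) L .one) ++ [.monomial, .minus]) ++
        (encNat a.den ++ (encFin encNat (SlotMonomial.expVec (k := k) L (.ratio (ptr .pos))) ++
          .endPoly :: w))) =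
      clauseText (SlotPoly.toSparse (k := k) L (SlotPoly.ratioEq a (ptr .pos))) ++ w := by
    have hden : encInt (-(a.den : ℤ)) = .minus :: encNat a.den := by
      simp [encInt, encSign, encNat, a.den_pos]
    simp [clauseText, encPoly, SlotPoly.toSparse, SlotPoly.ratioEq, encMonomial, hden]
  have hfirst : ∃ t ts, encSign a.num ++ bitsNat a.num.natAbs ++ [.slash] ++ encNat a.den =
      t :: ts ∧ t ≠ .matrix ∧ t ≠ .row ∧ t ≠ .rhs := by
    cases hdigits : encSign a.num ++ bitsNat a.num.natAbs with
    | nil => exact ⟨_, _, rfl, by decide⟩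
    | cons t ts =>
      refine ⟨t, _, rfl, ?_⟩
      obtain rfl | ⟨b, rfl⟩ := forall_mem_encSign_append_bitsNat a.num a.num.natAbs t
        (hdigits ▸ List.mem_cons_self ..) <;> simp
  obtain ⟨t, ts, hcons, ht⟩ := hfirst
  have hencRat : encRat a = t :: ts := by
    rw [← hcons]
    simp [encRat, encNat]
  rw [hcons] at hnumber
  rw [hencRat, transduce_read_fresh ht hnumber, htext]

end Reader

section Constraints

open Command

variable {L : ℕ}

theorem transduce_finish_false (i j p : ℕ) :
    transduce (armTransducer k).exec (ruler L (pointers i j p)) (finish false) =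
      (ruler L (pointers i (j + 1) (p + 1)), clauseText (SlotPoly.toSparse (k := k) L
        (SlotPoly.accNext i j p ++ [(-1, .acc (p + 1))]))) := by
  have haccNext := transduce_terms (k := k) L (pointers i j p) (.accNext .row .col .pos)
  rw [SlotPoly.mapPlaces_accNext] at haccNext
  simp [finish, openClause, transduce_append, transduce, haccNext, transduce_terms, clauseText,
    encPoly, SlotPoly.toSparse, SlotPoly.mapPlaces, pointers]

theorem transduce_finish_true (i j p : ℕ) :
    transduce (armTransducer k).exec (ruler L (pointers i j p)) (finish true) =
      (ruler L (pointers i j (p + 1)),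
        clauseText (SlotPoly.toSparse (k := k) L [(1, .acc p), (-1, .ratio p)]) ++
          clauseText (SlotPoly.toSparse (k := k) L [(1, .acc (p + 1))])) := by
  simp [finish, transduce_append, transduce, transduce_clause, SlotPoly.mapPlaces, pointers]

/-- The instructions that add the products of the row `r` with the row `i` of a matrix. -/
def rowInstructions {n : ℕ} (i : ℕ) (r : Fin n → ℚ) : List Instruction :=
  (List.finRange n).flatMap fun j : Fin n => [.add i j (r j)]

/-- The instructions for the affine constraint with the given matrix and right-hand side. -/
def constraintInstructions {m n : ℕ} (c : (Fin m → Fin n → ℚ) × ℚ) : List Instruction :=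
  (List.finRange m).flatMap (fun i : Fin m => rowInstructions (i + 1) (c.1 i)) ++ [.check c.2]

/-- The instructions for all constraints of an instance. -/
def ARMInstance.instructions (I : ARMInstance) : List Instruction :=
  (List.finRange I.q).flatMap fun l => constraintInstructions (I.A l, I.b l)

/-- The state of the reader together with the row and the column to which it points. -/
structure Location : Type where
  mode : Mode
  row : ℕ
  col : ℕ

/-- At the start of the text `ts` the reader is at `s`, at its end it is at `s'`, and on the way it
has written the polynomials for the instructions `l`. -/
def Reads (k L : ℕ) (s s' : Location) (ts : List Token) (l : List Instruction) : Prop :=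
  ∀ p, transduce (armTransducer k).read (s.mode, ruler L (pointers s.row s.col p)) ts =
    ((s'.mode, ruler L (pointers s'.row s'.col (p + l.length))),
      ((Instruction.polysFrom p l).map (SlotPoly.toSparse (k := k) L)).flatMap clauseText)

namespace Reads

open Instruction

theorem append {s s' s'' : Location} {ts ts' : List Token} {l l' : List Instruction}
    (h : Reads k L s s' ts l) (h' : Reads k L s' s'' ts' l') :
    Reads k L s s'' (ts ++ ts') (l ++ l') := by
  intro p
  rw [transduce_append_eq (h p) (h' _), polysFrom_append, List.length_append, List.map_append,
    List.flatMap_append, Nat.add_assoc]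

theorem family {ι : Type} {e : ι → List Token} {n : ℕ} {f : Fin n → ι}
    {F : Fin n → List Instruction} {σ : ℕ → Location}
    (h : ∀ i : Fin n, Reads k L (σ i) (σ (i + 1)) (e (f i)) (F i)) :
    Reads k L (σ 0) (σ n) (encFin e f) ((List.finRange n).flatMap F) := by
  induction n generalizing σ with
  | zero => exact fun _ => rfl
  | succ n ih =>
    rw [encFin, List.ofFn_succ, List.flatMap_cons, List.finRange_succ, List.flatMap_cons,
      List.flatMap_map]
    exact (h 0).append (ih (σ := fun i => σ (i + 1)) fun i => h i.succ)

theorem entry (i j : ℕ) (a : ℚ) :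
    Reads k L ⟨.fresh false, i, j⟩ ⟨.fresh false, i, j + 1⟩ (encRat a) [.add i j a] := by
  intro p
  rw [transduce_read_encRat a (transduce_finish_false i j p)]
  simp [Mode.afterNumber, polysFrom, polys, pointers]

theorem rhs (b : ℚ) : Reads k L ⟨.fresh true, 0, 0⟩ ⟨.outside, 0, 0⟩ (encRat b) [.check b] := by
  intro p
  rw [transduce_read_encRat b (transduce_finish_true 0 0 p)]
  simp [Mode.afterNumber, polysFrom, polys, pointers]

theorem of_next {s s' : Location} {t : Token} {l : List (Command k)}
    (hnext : s.mode.next t = (s'.mode, l))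
    (hl : ∀ p, transduce (armTransducer k).exec (ruler L (pointers s.row s.col p)) l =
      (ruler L (pointers s'.row s'.col p), [])) : Reads k L s s' [t] [] :=
  fun p => transduce_read_singleton hnext (hl p)

theorem row (i j : ℕ) {n : ℕ} (r : Fin n → ℚ) :
    Reads k L ⟨.fresh false, i, j⟩ ⟨.fresh false, i + 1, n⟩ (encRow r)
      (rowInstructions (i + 1) r) := by
  have hrow : Reads k L ⟨.fresh false, i, j⟩ ⟨.fresh false, i + 1, 0⟩ [.row] [] :=
    of_next rfl fun p => by simp [transduce, pointers]
  exact hrow.append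
    (family (σ := fun j' => ⟨.fresh false, i + 1, j'⟩) fun j' => entry (i + 1) j' (r j'))

theorem rows {m n : ℕ} (A : Fin m → Fin n → ℚ) :
    Reads k L ⟨.fresh false, 0, 0⟩ ⟨.fresh false, m, if m = 0 then 0 else n⟩
      (encFin encRow A)
      ((List.finRange m).flatMap fun i : Fin m => rowInstructions (i + 1) (A i)) :=
  family (σ := fun i => ⟨.fresh false, i, if i = 0 then 0 else n⟩) fun i => row i _ (A i)

theorem constraint {m n : ℕ} (c : (Fin m → Fin n → ℚ) × ℚ) :
    Reads k L ⟨.outside, 0, 0⟩ ⟨.outside, 0, 0⟩ (encConstraint c) (constraintInstructions c) := by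
  have hmatrix : Reads k L ⟨.outside, 0, 0⟩ ⟨.fresh false, 0, 0⟩ [.matrix] [] :=
    of_next rfl fun p => rfl
  have hrhs (j : ℕ) : Reads k L ⟨.fresh false, m, j⟩ ⟨.fresh true, 0, 0⟩ [.rhs] [] :=
    of_next rfl fun p => by simp [transduce]
  exact hmatrix.append ((rows c.1).append ((hrhs _).append (rhs c.2)))

theorem of_forall_next {s : Location} {ts : List Token}
    (hts : ∀ t ∈ ts, s.mode.next (k := k) t = (s.mode, [])) : Reads k L s s ts [] := by
  induction ts with
  | nil => exact fun _ => rfl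
  | cons t ts ih =>
    rw [List.forall_mem_cons] at hts
    exact (of_next hts.1 fun _ => rfl).append (ih hts.2)

theorem number (n : ℕ) : Reads k L ⟨.outside, 0, 0⟩ ⟨.outside, 0, 0⟩ (encNat n) [] := by
  refine of_forall_next fun t ht => ?_
  obtain ht | ht := List.mem_append.1 ht
  · obtain ⟨b, -, rfl⟩ := List.mem_map.1 ht
    rfl
  · rw [List.mem_singleton.1 ht]
    rfl

theorem encode (I : ARMInstance) :
    Reads k L ⟨.outside, 0, 0⟩ ⟨.outside, 0, 0⟩ I.encode I.instructions :=
  (((number I.m).append (number I.n)).append (number I.q)).append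
    (family (σ := fun _ => ⟨.outside, 0, 0⟩) fun _ => constraint _)

end Reads

/-- The sentence of the reduction, with one cell for each symbol of the instance. -/
noncomputable def ARMInstance.toETR (k : ℕ) (I : ARMInstance) : ETRSentence :=
  ⟨numVars k I.encode.length, Instruction.formula k I.encode.length I.instructions⟩

theorem setup_armTransducer (k L : ℕ) : (armTransducer k).setup L =
    (ruler L (pointers 0 0 0), List.replicate (numVars k L) .ex ++
      clauseText (SlotPoly.toSparse (k := k) L [(1, .acc 0)])) := by
  have hblank : List.replicate L (armTransducer k).blank = ruler L (pointers L L L) := by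
    refine (replicate_false L).trans (congrArg (ruler L) (funext fun a => ?_))
    cases a <;> rfl
  have hinitial : (armTransducer k).initial =
      [.quantify, .reset .row, .reset .col, .reset .pos] ++ clause [(1, .acc .pos)] := rfl
  rw [SweepTransducer.setup, hblank, hinitial]
  simp [transduce, transduce_clause, SlotPoly.mapPlaces, pointers]

theorem output_armTransducer (k : ℕ) (I : ARMInstance) :
    (armTransducer k).output I.encode = (I.toETR k).encode := by
  rw [SweepTransducer.output, setup_armTransducer]
  have hread := Reads.encode (k := k) (L := I.encode.length) I 0
  have hstart : (armTransducer k).start = .outside := rfl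
  have hfinal : (armTransducer k).final = [.eqZero, .endPoly] := rfl
  rw [hstart, hfinal, hread]
  simp [ETRSentence.encode, ARMInstance.toETR, Instruction.formula, encode_allZero]

end Constraints

end Text

/-! ### Correctness of the reduction -/

section Reduction

namespace Instruction

theorem accepts_rowInstructions_append {n : ℕ} (g : ℕ → ℕ → ℝ) (s : ℝ) (i : ℕ) (r : Fin n → ℚ)
    (l : List Instruction) :
    Accepts g s (rowInstructions i r ++ l) ↔ Accepts g (s + ∑ j, r j * g i j) l := by
  rw [Fin.sum_univ_def]
  exact accepts_flatMap_append (fun _ _ _ => .rfl) _ s l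

theorem accepts_constraintInstructions_append {m n : ℕ} (g : ℕ → ℕ → ℝ)
    (c : (Fin m → Fin n → ℚ) × ℚ) (l : List Instruction) :
    Accepts g 0 (constraintInstructions c ++ l) ↔
      ∑ i : Fin m, ∑ j : Fin n, c.1 i j * g (i + 1) j = c.2 ∧ Accepts g 0 l := by
  rw [constraintInstructions, List.append_assoc, accepts_flatMap_append fun i s l =>
    accepts_rowInstructions_append g s _ _ l, zero_add, ← Fin.sum_univ_def]
  rfl

theorem accepts_instructions_iff (I : ARMInstance) (g : ℕ → ℕ → ℝ) : Accepts g 0 I.instructions ↔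
    ∀ l, frobeniusInner (I.A l) (Matrix.of fun i j => g (i + 1) j) = I.b l := by
  have hlist (ls : List (Fin I.q)) :
      Accepts g 0 (ls.flatMap fun l => constraintInstructions (I.A l, I.b l)) ↔
        ∀ l ∈ ls, frobeniusInner (I.A l) (Matrix.of fun i j => g (i + 1) j) = I.b l := by
    induction ls with
    | nil => simp [Accepts]
    | cons l ls ih =>
      rw [List.flatMap_cons, accepts_constraintInstructions_append, ih, List.forall_mem_cons]
      rfl
  simpa [ARMInstance.instructions] using hlist (List.finRange I.q)

end Instruction

theorem length_flatMap_finRange_le_length_encFin {ι : Type} {e : ι → List Token} {n : ℕ}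
    {f : Fin n → ι} {F : Fin n → List Instruction} (h : ∀ i, (F i).length ≤ (e (f i)).length) :
    ((List.finRange n).flatMap F).length ≤ (encFin e f).length := by
  rw [encFin, List.ofFn_eq_map, List.flatMap_map, List.length_flatMap, List.length_flatMap]
  exact List.sum_le_sum fun i _ => h i

theorem length_constraintInstructions_le {m n : ℕ} (c : (Fin m → Fin n → ℚ) × ℚ) :
    (constraintInstructions c).length ≤ (encConstraint c).length := by
  have hnumber (a : ℚ) : 1 ≤ (encRat a).length := by
    simp only [encRat, List.length_append, List.length_cons, List.length_nil]
    omega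
  have hrow (i : ℕ) (r : Fin n → ℚ) : (rowInstructions i r).length ≤ (encRow r).length :=
    (length_flatMap_finRange_le_length_encFin (F := fun j => [.add i j (r j)])
      fun j => hnumber (r j)).trans (Nat.le_succ _)
  have hrows := length_flatMap_finRange_le_length_encFin (e := encRow) (f := c.1)
    fun i : Fin m => hrow (i + 1) (c.1 i)
  have hrhs := hnumber c.2
  simp only [constraintInstructions, encConstraint, List.length_append, List.length_cons,
    List.length_nil]
  omega

namespace ARMInstance

theorem length_instructions (I : ARMInstance) :
    I.instructions.length = I.q * (I.m * I.n + 1) := by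
  simp [instructions, constraintInstructions, rowInstructions, List.length_flatMap]

theorem length_instructions_lt (I : ARMInstance) : I.instructions.length < I.encode.length := by
  have hconstraints := length_flatMap_finRange_le_length_encFin (e := encConstraint)
    (f := fun l => (fun i j => I.A l i j, I.b l))
    fun l => length_constraintInstructions_le (I.A l, I.b l)
  have hheader : 0 < (encNat I.q).length := by simp [encNat]
  simp only [encode, instructions, List.length_append]
  omega

theorem below_instructions (I : ARMInstance) :
    ∀ x ∈ I.instructions, x.Below I.encode.length := by
  have hlength := I.length_instructions ▸ I.length_instructions_lt
  have hentry (l : Fin I.q) (i : Fin I.m) (j : Fin I.n) :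
      (i : ℕ) + 1 < I.encode.length ∧ (j : ℕ) < I.encode.length := by
    have hq : I.m * I.n + 1 ≤ I.q * (I.m * I.n + 1) := Nat.le_mul_of_pos_left _ l.pos
    have hm : I.m ≤ I.m * I.n := Nat.le_mul_of_pos_right _ j.pos
    have hn : I.n ≤ I.m * I.n := Nat.le_mul_of_pos_left _ i.pos
    omega
  simp only [instructions, constraintInstructions, rowInstructions, List.mem_flatMap,
    List.mem_append, List.mem_singleton]
  rintro x ⟨l, -, ⟨i, -, j, -, rfl⟩ | rfl⟩
  · exact hentry l i j
  · trivial

theorem exists_accepts_iff (k : ℕ) (I : ARMInstance) :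
    (∃ U V : ℕ → Fin k → ℝ, Instruction.Accepts (fun i j => ∑ t, U i t * V j t) 0 I.instructions) ↔
      ∃ (U : Matrix (Fin I.m) (Fin k) ℝ) (V : Matrix (Fin k) (Fin I.n) ℝ),
        ∀ l, frobeniusInner (I.A l) (U * V) = I.b l := by
  simp only [Instruction.accepts_instructions_iff]
  constructor
  · rintro ⟨U, V, h⟩
    exact ⟨Matrix.of fun i => U (i + 1), Matrix.of fun t j => V j t, h⟩
  · rintro ⟨U, V, h⟩
    refine ⟨Function.extend (fun i : Fin I.m => (i : ℕ) + 1) U 0,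
      Function.extend Fin.val (fun j t => V t j) 0, fun l => ?_⟩
    have hU : Function.Injective fun i : Fin I.m => (i : ℕ) + 1 :=
      (add_left_injective 1).comp Fin.val_injective
    convert h l using 2
    ext i j
    simp only [Matrix.of_apply, Matrix.mul_apply, hU.extend_apply U 0 i,
      Fin.val_injective.extend_apply]

theorem isTrue_toETR_iff (k : ℕ) (I : ARMInstance) : (I.toETR k).IsTrue ↔
    ∃ (U : Matrix (Fin I.m) (Fin k) ℝ) (V : Matrix (Fin k) (Fin I.n) ℝ),
      ∀ l, frobeniusInner (I.A l) (U * V) = I.b l :=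
  (Instruction.exists_sat_formula_iff I.below_instructions I.length_instructions_lt).trans
    (I.exists_accepts_iff k)

end ARMInstance

end Reduction

theorem ARMInstance.feasible_iff_exists_mul (k : ℕ) (I : ARMInstance) : I.Feasible k ↔
    ∃ (U : Matrix (Fin I.m) (Fin k) ℝ) (V : Matrix (Fin k) (Fin I.n) ℝ),
      ∀ l, frobeniusInner (I.A l) (U * V) = I.b l := by
  simp only [Feasible, rank_le_iff_exists_mul]
  constructor
  · rintro ⟨_, h, U, V, rfl⟩
    exact ⟨U, V, h⟩
  · rintro ⟨U, V, h⟩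
    exact ⟨U * V, h, U, V, rfl⟩

theorem mainTheorem2 (k : ℕ) (hk : 1 ≤ k) :
    ARM k ∈ ExistsR ∧
      ∀ I : ARMInstance, I.Feasible k ↔
        ∃ (U : Matrix (Fin I.m) (Fin k) ℝ) (V : Matrix (Fin k) (Fin I.n) ℝ),
          ∀ l, frobeniusInner (I.A l) (U * V) = I.b l := by
  have hcomputable : Nonempty (Turing.TM2ComputableInPolyTime ARMInstance.encode
      ETRSentence.encode (ARMInstance.toETR k)) :=
    (armTransducer k).nonempty_tm2ComputableInPolyTime fun I => (output_armTransducer k I).symm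
  have hcorrect (I : ARMInstance) : I.Feasible k ↔ (I.toETR k).IsTrue :=
    (I.feasible_iff_exists_mul k).trans (I.isTrue_toETR_iff k).symm
  exact ⟨⟨ARMInstance.toETR k, hcomputable, hcorrect⟩, ARMInstance.feasible_iff_exists_mul k⟩
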